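/- Work in a fixed Lorentzian frame with coordinates $(r_1,t)\in\mathbb R^3\times\mathbb R$ and speed of light $1$; write $D=\partial/\partial t$, $\nabla=(D_1,D_2,D_3)$ for the gradient in $r_1$, and $\Box^2=\nabla^2-D^2$. Let $m_0>0$ and let $r_2:\mathbb R\to\mathbb R^3$ be an admissible trajectory: $r_2$ is of class $C^3$, $|\dot r_2(t)|<1$ for all $t$, and for every $t_1$ the kinetic energy $m_0\big((1-|\dot r_2|^2)^{-1/2}-1\big)$ and the acceleration $|\ddot r_2|$ are bounded on $(-\infty,t_1]$. For every $(r_1,t)$ there is then a unique $\tau=\tau(r_1,t)\le t$ with $\tau=t-|r_1-r_2(\tau)|$ (the retarded time). Let $G=\{(r_1,t): r_1\neq r_2(t)\}$ be the set of points off the path, which is open and is the set where $T>0$, and define on $G$ the fundamental fields $$T=t-\tau,\quad r_{12}=r_1-r_2(\tau),\quad v=\dot r_2(\tau),\quad a=\ddot r_2(\tau),\quad u=\frac1T,\quad e=u\,r_{12},\quad z=\frac1{1-\langle e,v\rangle}.$$ Put $$E=u^2e+u^{-1}D(u^2e)+D^2e,\qquad B=e\times E,\qquad \phi=uz,\qquad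 A=uzv .$$ Then on $G$ the fields $u,e$ are of class $C^3$, the potentials $\phi,A$ are of class $C^2$, the fields $E,B$ are of class $C^1$, and the following hold on all of $G$. 1. (Maxwell) $\nabla\times E=-DB$, $\nabla\cdot E=0$, $\nabla\times B=DE$, $\nabla\cdot B=0$. 2. (Wave equations) $\Box^2E=0$ and $\Box^2B=0$ in the sense of distributions on $G$. They hold pointwise on every open subset of $G$ on which $E$ and $B$ are of class $C^2$. If $r_2$ is of class $C^4$, then $E$ and $B$ are of class $C^2$ on $G$, so they hold pointwise on all of $G$. 3. (Liénard–Wiechert potentials) $\Box^2A=0$, $\Box^2\phi=0$, $\nabla\cdot A+D\phi=0$, and $E=-\nabla\phi-DA$, $B=\nabla\times A$. 4. (Explicit formula) $$E=-uz^2a+uz^3\langle e,a\rangle e-uz^3\langle e,a\rangle v+u^2z^3e-u^2z^3\langle v,v\rangle e-u^2z^3v+u^2z^3\langle v,v\rangle v .$$ -/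

import Mathlib

open scoped ContDiff

noncomputable section

namespace BogdanFeynman

/-- Euclidean three-space. -/
abbrev R3 : Type := EuclideanSpace ℝ (Fin 3)

/-- Space-time `R³ × R` of a fixed Lorentzian frame: points `(r₁, t)`, with speed of light `1`. -/
abbrev Spacetime : Type := R3 × ℝ

/-! ### Differential operators on fields over space-time -/

section Operators

variable {F : Type*} [NormedAddCommGroup F] [NormedSpace ℝ F]

/-- The partial derivative `D_i` with respect to the `i`-th space coordinate. -/
def partialX (i : Fin 3) (f : Spacetime → F) (p : Spacetime) : F :=
  lineDeriv ℝ f p (EuclideanSpace.single i (1 : ℝ), 0)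

/-- The partial derivative `D` with respect to time. -/
def partialT (f : Spacetime → F) (p : Spacetime) : F :=
  lineDeriv ℝ f p (0, 1)

/-- The D'Alembertian `∇² - D²`, for scalar or vector fields. -/
def box (f : Spacetime → F) (p : Spacetime) : F :=
  (∑ i : Fin 3, partialX i (partialX i f) p) - partialT (partialT f) p

/-- `f` is locally integrable on the open set `G` and `∇² f - D² f = 0` on `G` in the sense of
distributions. -/
def WeakWaveOn (G : Set Spacetime) (f : Spacetime → F) : Prop :=
  MeasureTheory.LocallyIntegrableOn f G ∧
    ∀ ψ : Spacetime → ℝ, ContDiff ℝ ∞ ψ → HasCompactSupport ψ → tsupport ψ ⊆ G →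
      ∫ p, box ψ p • f p = 0

end Operators

/-- The gradient `∇ f` in the space variables. -/
def grad (f : Spacetime → ℝ) (p : Spacetime) : R3 :=
  WithLp.toLp 2 fun i => partialX i f p

/-- The divergence `∇ · A` in the space variables. -/
def div (A : Spacetime → R3) (p : Spacetime) : ℝ :=
  ∑ i : Fin 3, partialX i (fun q => A q i) p

/-- The curl `∇ × A` in the space variables. -/
def curl (A : Spacetime → R3) (p : Spacetime) : R3 :=
  !₂[partialX 1 (fun q => A q 2) p - partialX 2 (fun q => A q 1) p,
     partialX 2 (fun q => A q 0) p - partialX 0 (fun q => A q 2) p,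
     partialX 0 (fun q => A q 1) p - partialX 1 (fun q => A q 0) p]

/-- The vector product on Euclidean three-space. -/
def cross (a b : R3) : R3 :=
  WithLp.toLp 2 (crossProduct (WithLp.ofLp a) (WithLp.ofLp b))

/-! ### Admissible trajectories and the retarded time -/

/-- The relativistic kinetic energy of a body with rest mass `m₀` and velocity `v`, `|v| < 1`. -/
def kineticEnergy (m₀ : ℝ) (v : R3) : ℝ :=
  m₀ * (1 / Real.sqrt (1 - ‖v‖ ^ 2) - 1)

/-- Admissible trajectories of a point of rest mass `m₀`: of class `C³`, slower than light, and
with kinetic energy and acceleration bounded on every interval `(-∞, t₁]`. -/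
structure IsAdmissible (m₀ : ℝ) (r₂ : ℝ → R3) : Prop where
  contDiff : ContDiff ℝ 3 r₂
  speed_lt_one : ∀ t, ‖deriv r₂ t‖ < 1
  kineticEnergy_bounded :
    ∀ t₁ : ℝ, ∃ K : ℝ, ∀ s ≤ t₁, kineticEnergy m₀ (deriv r₂ s) ≤ K
  acceleration_bounded :
    ∀ t₁ : ℝ, ∃ A : ℝ, ∀ s ≤ t₁, ‖deriv (deriv r₂) s‖ ≤ A

/-- The set of points of space-time that do not lie on the path. -/
def offPath (r₂ : ℝ → R3) : Set Spacetime := {p | p.1 ≠ r₂ p.2}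

/-- `s` is a retarded time for the point `p = (r₁, t)`: `s ≤ t` and `s = t - |r₁ - r₂(s)|`. -/
def IsRetardedTime (r₂ : ℝ → R3) (p : Spacetime) (s : ℝ) : Prop :=
  s ≤ p.2 ∧ s = p.2 - ‖p.1 - r₂ s‖

/-- The retarded time field `τ`. For an admissible trajectory it is the unique retarded time. -/
def tau (r₂ : ℝ → R3) (p : Spacetime) : ℝ :=
  Classical.epsilon (IsRetardedTime r₂ p)

/-! ### The fundamental fields of a trajectory -/

/-- The delay `T = t - τ`. -/
def delay (r₂ : ℝ → R3) (p : Spacetime) : ℝ := p.2 - tau r₂ p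

/-- The vector field `r₁₂ = r₁ - r₂ ∘ τ`. -/
def r12 (r₂ : ℝ → R3) (p : Spacetime) : R3 := p.1 - r₂ (tau r₂ p)

/-- The retarded velocity `v`. -/
def vel (r₂ : ℝ → R3) (p : Spacetime) : R3 := deriv r₂ (tau r₂ p)

/-- The retarded acceleration `a`. -/
def acc (r₂ : ℝ → R3) (p : Spacetime) : R3 := deriv (deriv r₂) (tau r₂ p)

/-- The field `u = 1 / T`. -/
def uField (r₂ : ℝ → R3) (p : Spacetime) : ℝ := 1 / delay r₂ p

/-- The unit vector field `e = u r₁₂`. -/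
def eField (r₂ : ℝ → R3) (p : Spacetime) : R3 := uField r₂ p • r12 r₂ p

/-- The field `z = 1 / (1 - ⟨e, v⟩)`. -/
def zField (r₂ : ℝ → R3) (p : Spacetime) : ℝ :=
  1 / (1 - inner ℝ (eField r₂ p) (vel r₂ p))

/-! ### The electromagnetic fields and the potentials -/

/-- The amended Newton–Feynman field `E = u² e + u⁻¹ D(u² e) + D² e`. -/
def elec (r₂ : ℝ → R3) (p : Spacetime) : R3 :=
  (uField r₂ p) ^ 2 • eField r₂ p
    + (uField r₂ p)⁻¹ • partialT (fun q => (uField r₂ q) ^ 2 • eField r₂ q) p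
    + partialT (partialT (eField r₂)) p

/-- The associated magnetic field `B = e × E`. -/
def magn (r₂ : ℝ → R3) (p : Spacetime) : R3 := cross (eField r₂ p) (elec r₂ p)

/-- The Liénard–Wiechert scalar potential `φ = u z`. -/
def scalarPot (r₂ : ℝ → R3) (p : Spacetime) : ℝ := uField r₂ p * zField r₂ p

/-- The Liénard–Wiechert vector potential `A = u z v`. -/
def vectorPot (r₂ : ℝ → R3) (p : Spacetime) : R3 :=
  (uField r₂ p * zField r₂ p) • vel r₂ p

/-! ### The fields are well defined -/

theorem IsAdmissible.differentiable {m₀ : ℝ} {r₂ : ℝ → R3} (h : IsAdmissible m₀ r₂) :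
    Differentiable ℝ r₂ :=
  h.contDiff.differentiable (by norm_num)

theorem isOpen_offPath {m₀ : ℝ} {r₂ : ℝ → R3} (h : IsAdmissible m₀ r₂) :
    IsOpen (offPath r₂) :=
  isOpen_ne_fun continuous_fst (h.contDiff.continuous.comp continuous_snd)

/-- A bound on the kinetic energy yields a bound below `1` on the speed. -/
theorem IsAdmissible.exists_speed_bound {m₀ : ℝ} (hm : 0 < m₀) {r₂ : ℝ → R3}
    (h : IsAdmissible m₀ r₂) (t : ℝ) : ∃ q : ℝ, 0 ≤ q ∧ q < 1 ∧ ∀ s ≤ t, ‖deriv r₂ s‖ ≤ q := by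
  obtain ⟨K, hK⟩ := h.kineticEnergy_bounded t
  set c : ℝ := max 1 (1 + K / m₀) with hc
  have hc1 : 1 ≤ c := le_max_left _ _
  have hcinv : 0 < 1 / c ^ 2 := by positivity
  have hcle : 1 / c ^ 2 ≤ 1 := by
    rw [div_le_one (by positivity)]; nlinarith
  refine ⟨Real.sqrt (1 - 1 / c ^ 2), Real.sqrt_nonneg _, ?_, ?_⟩
  · rw [Real.sqrt_lt' one_pos]; linarith
  · intro s hs
    have hv := h.speed_lt_one s
    have hv0 := norm_nonneg (deriv r₂ s)
    have hpos : 0 < 1 - ‖deriv r₂ s‖ ^ 2 := by nlinarith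
    have hsq : 0 < Real.sqrt (1 - ‖deriv r₂ s‖ ^ 2) := Real.sqrt_pos.2 hpos
    have h1 := hK s hs
    unfold kineticEnergy at h1
    have h2 : 1 / Real.sqrt (1 - ‖deriv r₂ s‖ ^ 2) ≤ c := by
      refine le_trans ?_ (le_max_right _ _)
      have : 1 / Real.sqrt (1 - ‖deriv r₂ s‖ ^ 2) - 1 ≤ K / m₀ := by
        rw [le_div_iff₀ hm]; linarith
      linarith
    apply Real.le_sqrt_of_sq_le
    have h3 : 1 / c ≤ Real.sqrt (1 - ‖deriv r₂ s‖ ^ 2) := by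
      rw [div_le_iff₀ (by positivity)]
      rw [div_le_iff₀ hsq] at h2
      linarith
    have h4 : (1 / c) ^ 2 ≤ 1 - ‖deriv r₂ s‖ ^ 2 := by
      rw [← Real.sq_sqrt hpos.le]
      exact pow_le_pow_left₀ (by positivity) h3 2
    rw [div_pow, one_pow] at h4
    linarith

/-- The retarded time exists and is unique. -/
theorem existsUnique_isRetardedTime {m₀ : ℝ} (hm : 0 < m₀) {r₂ : ℝ → R3}
    (h : IsAdmissible m₀ r₂) (p : Spacetime) : ∃! s, IsRetardedTime r₂ p s := by
  obtain ⟨q, hq0, hq1, hq⟩ := h.exists_speed_bound hm p.2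
  have lip : ∀ s ≤ p.2, ∀ s' ≤ p.2, ‖r₂ s' - r₂ s‖ ≤ q * ‖s' - s‖ := fun s hs s' hs' =>
    Convex.norm_image_sub_le_of_norm_deriv_le (s := Set.Iic p.2)
      (fun x _ => h.differentiable x) (fun x hx => hq x hx) (convex_Iic _) hs hs'
  have hcont : Continuous fun s : ℝ => s + ‖p.1 - r₂ s‖ := by
    have := h.contDiff.continuous
    fun_prop
  set M := ‖p.1 - r₂ p.2‖ with hM
  have hM0 : 0 ≤ M := norm_nonneg _
  have hd : 0 ≤ M / (1 - q) := div_nonneg hM0 (by linarith)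
  obtain ⟨s, hs, hs'⟩ : p.2 ∈ (fun s : ℝ => s + ‖p.1 - r₂ s‖) ''
      Set.Icc (p.2 - M / (1 - q)) p.2 := by
    refine intermediate_value_Icc (by linarith) hcont.continuousOn ⟨?_, ?_⟩
    · have h1 := lip _ (by linarith : p.2 - M / (1 - q) ≤ p.2) p.2 le_rfl
      have h2 : ‖p.1 - r₂ (p.2 - M / (1 - q))‖ ≤ M + ‖r₂ p.2 - r₂ (p.2 - M / (1 - q))‖ := by
        have := norm_add_le (p.1 - r₂ p.2) (r₂ p.2 - r₂ (p.2 - M / (1 - q)))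
        simpa using this
      have h3 : ‖p.2 - (p.2 - M / (1 - q))‖ = M / (1 - q) := by
        rw [sub_sub_cancel, Real.norm_of_nonneg hd]
      rw [h3] at h1
      have h4 : M / (1 - q) * (1 - q) = M := div_mul_cancel₀ _ (by linarith)
      nlinarith
    · linarith
  refine ⟨s, ⟨hs.2, by dsimp only at hs'; linarith⟩, ?_⟩
  rintro s₁ ⟨hle, heq⟩
  dsimp only at hs'
  have h1 := lip s hs.2 s₁ hle
  have h2 : |s₁ - s| ≤ ‖r₂ s₁ - r₂ s‖ := by
    have h3 := abs_norm_sub_norm_le (p.1 - r₂ s) (p.1 - r₂ s₁)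
    have h4 : s₁ - s = ‖p.1 - r₂ s‖ - ‖p.1 - r₂ s₁‖ := by linarith
    rw [h4]
    simpa using h3
  rw [Real.norm_eq_abs] at h1
  have h5 : |s₁ - s| ≤ 0 := by
    nlinarith [abs_nonneg (s₁ - s)]
  exact sub_eq_zero.1 (abs_nonpos_iff.1 h5)

/-- `τ` satisfies its defining relation. -/
theorem isRetardedTime_tau {m₀ : ℝ} (hm : 0 < m₀) {r₂ : ℝ → R3}
    (h : IsAdmissible m₀ r₂) (p : Spacetime) : IsRetardedTime r₂ p (tau r₂ p) :=
  Classical.epsilon_spec (existsUnique_isRetardedTime hm h p).exists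

/-- The delay equals the distance to the retarded position, and is positive off the path. -/
theorem delay_eq_norm {m₀ : ℝ} (hm : 0 < m₀) {r₂ : ℝ → R3}
    (h : IsAdmissible m₀ r₂) (p : Spacetime) : delay r₂ p = ‖r12 r₂ p‖ := by
  have := (isRetardedTime_tau hm h p).2
  unfold delay r12
  linarith

theorem mem_offPath_iff {m₀ : ℝ} (hm : 0 < m₀) {r₂ : ℝ → R3}
    (h : IsAdmissible m₀ r₂) (p : Spacetime) : p ∈ offPath r₂ ↔ 0 < delay r₂ p := by
  rw [delay_eq_norm hm h, norm_pos_iff, r12, sub_ne_zero]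
  refine not_congr ⟨fun hp => ?_, fun hp => ?_⟩
  · have h1 : IsRetardedTime r₂ p p.2 := ⟨le_rfl, by rw [hp]; simp⟩
    rw [(existsUnique_isRetardedTime hm h p).unique (isRetardedTime_tau hm h p) h1, hp]
  · have h1 := (isRetardedTime_tau hm h p).2
    rw [← hp, sub_self, norm_zero, sub_zero] at h1
    rw [← h1, ← hp]

/-- The denominator of `z` is positive. -/
theorem one_sub_inner_pos {m₀ : ℝ} (hm : 0 < m₀) {r₂ : ℝ → R3}
    (h : IsAdmissible m₀ r₂) (p : Spacetime) :
    0 < 1 - inner ℝ (eField r₂ p) (vel r₂ p) := by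
  have he : ‖eField r₂ p‖ ≤ 1 := by
    rw [eField, uField, delay_eq_norm hm h, norm_smul, norm_div, norm_one, norm_norm, one_div]
    exact inv_mul_le_one
  have hv : ‖vel r₂ p‖ < 1 := h.speed_lt_one _
  have := real_inner_le_norm (eField r₂ p) (vel r₂ p)
  nlinarith [norm_nonneg (eField r₂ p), norm_nonneg (vel r₂ p)]

end BogdanFeynman

end

open BogdanFeynman

/-! Everything follows from the retarded time. The map (x, s) ↦ (x, s + |x - r₂(s)|) has an
invertible derivative off the path because 1 - ⟨e, v⟩ > 0. By the inverse function theorem `tau` is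
as smooth as r₂, with Dτ = z and ∇τ = -z e. Hence the first derivatives of u, e, z, v are
polynomials in u, z, e, v, a, ⟨e, a⟩ and ⟨v, v⟩. The relations used are |e| = 1 and z⟨e, v⟩ = z - 1.
Substituting into the definition of E gives the explicit formula (`elec_eq`). Comparing it with the
first derivatives of φ = uz and A = φv gives E = -∇φ - DA, B = ∇ × A and the Lorenz gauge.

The wave equations for the potentials rest on three facts: τ solves the eikonal equation |∇τ|² =
(Dτ)²; z is constant along the light rays, that is, in the direction (e, 1); and □²τ = -2φ
(`box_tau`). Since z = Dτ, □²z = -2Dφ without computing second derivatives of z, and the product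
rule for uz gives □²φ = 0 (`box_scalarPot`). In □²A the eikonal equation removes the third
derivative of r₂, and the transport of φ along the rays removes the rest (`box_vectorPot`).

Maxwell's equations are then the usual consequence of the gauge, the wave equations and the symmetry
of second derivatives (`maxwell_of_potentials`). For r₂ of class C³, E and B are only known to be
C¹, so their wave equations are obtained weakly: their components are combinations of first
derivatives of C² solutions, and such derivatives are weak solutions (`weakWaveOn_dirDeriv`). Where
the fields are C², integration by parts and continuity recover the pointwise equations. -/

noncomputable section

namespace BogdanFeynman

open MeasureTheory Topology

/-! ### Directional derivatives and the D'Alembertian on an open set. -/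

section Calculus

variable {F : Type*} [NormedAddCommGroup F] [NormedSpace ℝ F] {G : Set Spacetime}
  {f g : Spacetime → F} {p : Spacetime}

/-- The derivative of a field in a fixed direction of space-time. -/
def dirDeriv (w : Spacetime) (f : Spacetime → F) (p : Spacetime) : F := lineDeriv ℝ f p w

/-- The unit vector of the `i`-th space coordinate. -/
def basisX (i : Fin 3) : Spacetime := (EuclideanSpace.single i (1 : ℝ), 0)

/-- The unit vector of the time coordinate. -/
def basisT : Spacetime := (0, 1)

theorem partialX_eq (i : Fin 3) (f : Spacetime → F) : partialX i f = dirDeriv (basisX i) f := rfl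

theorem partialT_eq (f : Spacetime → F) : partialT f = dirDeriv basisT f := rfl

theorem box_eq (f : Spacetime → F) (p : Spacetime) :
    box f p = (∑ i : Fin 3, dirDeriv (basisX i) (dirDeriv (basisX i) f) p)
      - dirDeriv basisT (dirDeriv basisT f) p := rfl

theorem dirDeriv_eq_fderiv (h : DifferentiableAt ℝ f p) (w : Spacetime) :
    dirDeriv w f p = fderiv ℝ f p w :=
  h.lineDeriv_eq_fderiv

theorem dirDeriv_of_hasFDerivAt {f' : Spacetime →L[ℝ] F} (h : HasFDerivAt f f' p)
    (w : Spacetime) : dirDeriv w f p = f' w :=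
  (h.hasLineDerivAt w).lineDeriv

theorem dirDeriv_congr (hG : IsOpen G) (h : Set.EqOn f g G) (hp : p ∈ G) (w : Spacetime) :
    dirDeriv w f p = dirDeriv w g p :=
  (h.eventuallyEq_of_mem (hG.mem_nhds hp)).lineDeriv_eq

theorem differentiableAt_of_contDiffOn {n : ℕ∞ω} (hG : IsOpen G) (h : ContDiffOn ℝ n f G)
    (hn : n ≠ 0) (hp : p ∈ G) : DifferentiableAt ℝ f p :=
  (h.contDiffAt (hG.mem_nhds hp)).differentiableAt hn

theorem eqOn_dirDeriv_fderiv {n : ℕ∞ω} (hG : IsOpen G) (h : ContDiffOn ℝ n f G)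
    (hn : n ≠ 0) (w : Spacetime) : Set.EqOn (dirDeriv w f) (fun p => fderiv ℝ f p w) G :=
  fun _ hp => dirDeriv_eq_fderiv (differentiableAt_of_contDiffOn hG h hn hp) w

theorem ContDiffOn.dirDeriv {m n : ℕ∞ω} (hG : IsOpen G) (h : ContDiffOn ℝ n f G)
    (hmn : m + 1 ≤ n) (w : Spacetime) : ContDiffOn ℝ m (dirDeriv w f) G := by
  have hn : n ≠ 0 := by
    rintro rfl
    simp at hmn
  exact ((h.fderiv_of_isOpen hG hmn).clm_apply contDiffOn_const).congr
    (eqOn_dirDeriv_fderiv hG h hn w)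

theorem dirDeriv_comm (hG : IsOpen G) (h : ContDiffOn ℝ 2 f G) (hp : p ∈ G)
    (w w' : Spacetime) : dirDeriv w (dirDeriv w' f) p = dirDeriv w' (dirDeriv w f) p := by
  have hd : DifferentiableAt ℝ (fderiv ℝ f) p :=
    differentiableAt_of_contDiffOn hG (h.fderiv_of_isOpen (m := 1) hG (by norm_num)) (by simp) hp
  have key : ∀ a b : Spacetime,
      dirDeriv a (dirDeriv b f) p = fderiv ℝ (fderiv ℝ f) p a b := by
    intro a b
    rw [dirDeriv_congr hG (eqOn_dirDeriv_fderiv hG h (by simp) b) hp,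
      dirDeriv_of_hasFDerivAt (hd.hasFDerivAt.clm_apply (hasFDerivAt_const b p))]
    simp
  rw [key, key]
  exact (h.contDiffAt (hG.mem_nhds hp)).isSymmSndFDerivAt (by simp) w w'

theorem dirDeriv_add (hf : DifferentiableAt ℝ f p) (hg : DifferentiableAt ℝ g p)
    (w : Spacetime) :
    dirDeriv w (fun q => f q + g q) p = dirDeriv w f p + dirDeriv w g p := by
  rw [dirDeriv_of_hasFDerivAt (hf.hasFDerivAt.fun_add hg.hasFDerivAt), dirDeriv_eq_fderiv hf,
    dirDeriv_eq_fderiv hg]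
  rfl

theorem dirDeriv_sub (hf : DifferentiableAt ℝ f p) (hg : DifferentiableAt ℝ g p)
    (w : Spacetime) :
    dirDeriv w (fun q => f q - g q) p = dirDeriv w f p - dirDeriv w g p := by
  rw [dirDeriv_of_hasFDerivAt (hf.hasFDerivAt.fun_sub hg.hasFDerivAt), dirDeriv_eq_fderiv hf,
    dirDeriv_eq_fderiv hg]
  rfl

theorem dirDeriv_neg (hf : DifferentiableAt ℝ f p) (w : Spacetime) :
    dirDeriv w (fun q => -f q) p = -dirDeriv w f p := by
  rw [dirDeriv_of_hasFDerivAt hf.hasFDerivAt.fun_neg, dirDeriv_eq_fderiv hf]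
  rfl

theorem dirDeriv_sum {ι : Type*} (s : Finset ι) {f : ι → Spacetime → F}
    (hf : ∀ i ∈ s, DifferentiableAt ℝ (f i) p) (w : Spacetime) :
    dirDeriv w (fun q => ∑ i ∈ s, f i q) p = ∑ i ∈ s, dirDeriv w (f i) p := by
  rw [dirDeriv_of_hasFDerivAt (HasFDerivAt.fun_sum fun i hi => (hf i hi).hasFDerivAt),
    sum_apply]
  exact Finset.sum_congr rfl fun i hi => (dirDeriv_eq_fderiv (hf i hi) w).symm

theorem dirDeriv_smul {c : Spacetime → ℝ} (hc : DifferentiableAt ℝ c p)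
    (hf : DifferentiableAt ℝ f p) (w : Spacetime) :
    dirDeriv w (fun q => c q • f q) p = c p • dirDeriv w f p + dirDeriv w c p • f p := by
  rw [dirDeriv_of_hasFDerivAt (hc.hasFDerivAt.fun_smul hf.hasFDerivAt), dirDeriv_eq_fderiv hf,
    dirDeriv_eq_fderiv hc]
  rfl

theorem dirDeriv_mul {c d : Spacetime → ℝ} (hc : DifferentiableAt ℝ c p)
    (hd : DifferentiableAt ℝ d p) (w : Spacetime) :
    dirDeriv w (fun q => c q * d q) p = c p * dirDeriv w d p + dirDeriv w c p * d p :=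
  dirDeriv_smul hc hd w

theorem dirDeriv_apply {A : Spacetime → R3} (hA : DifferentiableAt ℝ A p) (w : Spacetime)
    (i : Fin 3) : dirDeriv w (fun q => A q i) p = dirDeriv w A p i := by
  have h := (EuclideanSpace.proj i : R3 →L[ℝ] ℝ).hasFDerivAt.comp p hA.hasFDerivAt
  rw [dirDeriv_eq_fderiv hA]
  exact dirDeriv_of_hasFDerivAt h w

theorem box_congr (hG : IsOpen G) (h : Set.EqOn f g G) (hp : p ∈ G) : box f p = box g p := by
  have key (w : Spacetime) : dirDeriv w (dirDeriv w f) p = dirDeriv w (dirDeriv w g) p :=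
    dirDeriv_congr hG (fun q hq => dirDeriv_congr hG h hq w) hp w
  simp only [box_eq, key]

theorem dirDeriv_dirDeriv_smul {c : Spacetime → ℝ} (hG : IsOpen G) (hc : ContDiffOn ℝ 2 c G)
    (hf : ContDiffOn ℝ 2 f G) (hp : p ∈ G) (w : Spacetime) :
    dirDeriv w (dirDeriv w fun q => c q • f q) p =
      c p • dirDeriv w (dirDeriv w f) p + dirDeriv w (dirDeriv w c) p • f p
        + (2 : ℝ) • (dirDeriv w c p • dirDeriv w f p) := by
  have hc1 {q} (hq : q ∈ G) := differentiableAt_of_contDiffOn hG hc (by simp) hq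
  have hf1 {q} (hq : q ∈ G) := differentiableAt_of_contDiffOn hG hf (by simp) hq
  have hc2 := differentiableAt_of_contDiffOn hG
    (ContDiffOn.dirDeriv (m := 1) hG hc (by norm_num) w) (by simp) hp
  have hf2 := differentiableAt_of_contDiffOn hG
    (ContDiffOn.dirDeriv (m := 1) hG hf (by norm_num) w) (by simp) hp
  rw [dirDeriv_congr hG (fun q hq => dirDeriv_smul (hc1 hq) (hf1 hq) w) hp,
    dirDeriv_add ((hc1 hp).fun_smul hf2) (hc2.fun_smul (hf1 hp)), dirDeriv_smul (hc1 hp) hf2,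
    dirDeriv_smul hc2 (hf1 hp)]
  module

theorem box_smul {c : Spacetime → ℝ} (hG : IsOpen G) (hc : ContDiffOn ℝ 2 c G)
    (hf : ContDiffOn ℝ 2 f G) (hp : p ∈ G) :
    box (fun q => c q • f q) p = c p • box f p + box c p • f p
      + (2 : ℝ) • ((∑ i, dirDeriv (basisX i) c p • dirDeriv (basisX i) f p)
        - dirDeriv basisT c p • dirDeriv basisT f p) := by
  simp only [box_eq, dirDeriv_dirDeriv_smul hG hc hf hp, Fin.sum_univ_three]
  module

theorem box_dirDeriv (hG : IsOpen G) (hf : ContDiffOn ℝ 3 f G) (hp : p ∈ G) (w : Spacetime) :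
    box (dirDeriv w f) p = dirDeriv w (box f) p := by
  have h1 (v : Spacetime) : ContDiffOn ℝ 2 (dirDeriv v f) G :=
    ContDiffOn.dirDeriv hG hf (by norm_num) v
  have h2 (v : Spacetime) : DifferentiableAt ℝ (dirDeriv v (dirDeriv v f)) p :=
    differentiableAt_of_contDiffOn hG (ContDiffOn.dirDeriv (m := 1) hG (h1 v) (by norm_num) v)
      (by simp) hp
  have key (v : Spacetime) : dirDeriv v (dirDeriv v (dirDeriv w f)) p
      = dirDeriv w (dirDeriv v (dirDeriv v f)) p := by
    -- The direction `w` moves outward past one `v` at a time. The inner exchange holds on all of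
    -- `G`, so it may be differentiated.
    rw [dirDeriv_congr hG (fun q hq => dirDeriv_comm hG (hf.of_le (by norm_num)) hq v w) hp,
      dirDeriv_comm hG (h1 v) hp]
  have : box f = fun q => (∑ i : Fin 3, dirDeriv (basisX i) (dirDeriv (basisX i) f) q)
      - dirDeriv basisT (dirDeriv basisT f) q := rfl
  rw [this, dirDeriv_sub (DifferentiableAt.fun_sum fun i _ => h2 _) (h2 _),
    dirDeriv_sum _ fun i _ => h2 _, box_eq]
  simp only [key]

theorem continuousOn_box (hG : IsOpen G) (hf : ContDiffOn ℝ 2 f G) : ContinuousOn (box f) G := by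
  have h (w : Spacetime) : ContinuousOn (dirDeriv w (dirDeriv w f)) G :=
    (ContDiffOn.dirDeriv (m := 0) hG
      (ContDiffOn.dirDeriv (m := 1) hG hf (by norm_num) w) (by norm_num) w).continuousOn
  exact (continuousOn_finsetSum _ fun i _ => h _).sub (h _)

end Calculus

/-! ### Test functions, integration by parts and weak solutions. -/

section Weak

variable {F : Type*} [NormedAddCommGroup F] [NormedSpace ℝ F] {G : Set Spacetime}
  {f : Spacetime → F}

theorem contDiff_dirDeriv {ψ : Spacetime → ℝ} (hψ : ContDiff ℝ ∞ ψ) (w : Spacetime) :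
    ContDiff ℝ ∞ (dirDeriv w ψ) :=
  contDiffOn_univ.1 (ContDiffOn.dirDeriv isOpen_univ hψ.contDiffOn (by simp) w)

theorem tsupport_dirDeriv_subset (ψ : Spacetime → ℝ) (w : Spacetime) :
    tsupport (dirDeriv w ψ) ⊆ tsupport ψ := by
  refine closure_minimal (fun p hp => ?_) (isClosed_tsupport ψ)
  by_contra h
  apply hp
  have : ψ =ᶠ[𝓝 p] fun _ => 0 := notMem_tsupport_iff_eventuallyEq.1 h
  rw [dirDeriv, this.lineDeriv_eq]
  simp [lineDeriv]

theorem hasCompactSupport_dirDeriv {ψ : Spacetime → ℝ} (h : HasCompactSupport ψ)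
    (w : Spacetime) : HasCompactSupport (dirDeriv w ψ) :=
  h.of_isClosed_subset (isClosed_tsupport _) (tsupport_dirDeriv_subset ψ w)

/-- Although `f` is controlled only on `G`, the product is continuous on all of space-time: it
vanishes near every point outside the support of `ψ`. Compact support then gives integrability. -/
theorem integrable_smul_of_tsupport_subset {ψ : Spacetime → ℝ} (hG : IsOpen G)
    (hψ : Continuous ψ) (hs : HasCompactSupport ψ) (hψG : tsupport ψ ⊆ G)
    (hf : ContinuousOn f G) : Integrable fun p => ψ p • f p := by
  have hc : Continuous fun p => ψ p • f p := by
    refine continuous_iff_continuousAt.2 fun p => ?_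
    by_cases hp : p ∈ tsupport ψ
    · exact hψ.continuousAt.smul (hf.continuousAt (hG.mem_nhds (hψG hp)))
    · have : ψ =ᶠ[𝓝 p] fun _ => 0 := notMem_tsupport_iff_eventuallyEq.1 hp
      have h0 : (fun p => ψ p • f p) =ᶠ[𝓝 p] fun _ => 0 := by
        filter_upwards [this] with q hq
        rw [hq, zero_smul]
      exact continuousAt_const.congr h0.symm
  exact hc.integrable_of_hasCompactSupport hs.smul_right

instance : (volume : Measure Spacetime).IsAddHaarMeasure :=
  inferInstanceAs ((volume : Measure R3).prod (volume : Measure ℝ)).IsAddHaarMeasure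

theorem integral_dirDeriv_smul {ψ : Spacetime → ℝ} (hG : IsOpen G)
    (hψ : ContDiff ℝ ∞ ψ) (hs : HasCompactSupport ψ) (hψG : tsupport ψ ⊆ G)
    (hf : ContDiffOn ℝ 1 f G) (w : Spacetime) :
    ∫ p, dirDeriv w ψ p • f p = -∫ p, ψ p • dirDeriv w f p := by
  have hfd : ∀ p ∈ tsupport ψ, DifferentiableAt ℝ f p := fun p hp =>
    differentiableAt_of_contDiffOn hG hf (by simp) (hψG hp)
  have h := integral_bilinear_hasLineDerivAt_right_eq_neg_left_of_integrable
    (μ := (volume : Measure Spacetime)) (f := ψ) (f' := dirDeriv w ψ) (g := f)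
    (g' := dirDeriv w f) (v := w) (B := ContinuousLinearMap.lsmul ℝ ℝ)
    (integrable_smul_of_tsupport_subset hG (contDiff_dirDeriv hψ w).continuous
      (hasCompactSupport_dirDeriv hs w) ((tsupport_dirDeriv_subset ψ w).trans hψG) hf.continuousOn)
    (integrable_smul_of_tsupport_subset hG hψ.continuous hs hψG
      (ContDiffOn.dirDeriv (m := 0) hG hf (by norm_num) w).continuousOn)
    (integrable_smul_of_tsupport_subset hG hψ.continuous hs hψG hf.continuousOn)
    (fun p _ => ((hψ.differentiable (by simp)) p).lineDifferentiableAt.hasLineDerivAt)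
    -- Differentiability of `f` is needed only on the support of `ψ`, which lies in `G`.
    (fun p hp => (hfd p hp).lineDifferentiableAt.hasLineDerivAt)
  simp only [ContinuousLinearMap.lsmul_apply] at h
  rw [h, neg_neg]

theorem integral_box_smul {ψ : Spacetime → ℝ} (hG : IsOpen G)
    (hψ : ContDiff ℝ ∞ ψ) (hs : HasCompactSupport ψ) (hψG : tsupport ψ ⊆ G)
    (hf : ContDiffOn ℝ 2 f G) : ∫ p, box ψ p • f p = ∫ p, ψ p • box f p := by
  have hf' (w : Spacetime) : ContDiffOn ℝ 1 (dirDeriv w f) G :=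
    ContDiffOn.dirDeriv hG hf (by norm_num) w
  have hsub (w : Spacetime) := (tsupport_dirDeriv_subset ψ w).trans hψG
  have hsub' (w : Spacetime) := (tsupport_dirDeriv_subset (dirDeriv w ψ) w).trans (hsub w)
  have key (w : Spacetime) : ∫ p, dirDeriv w (dirDeriv w ψ) p • f p
      = ∫ p, ψ p • dirDeriv w (dirDeriv w f) p := by
    rw [integral_dirDeriv_smul hG (contDiff_dirDeriv hψ w) (hasCompactSupport_dirDeriv hs w)
      (hsub w) (hf.of_le (by norm_num)),
      integral_dirDeriv_smul hG hψ hs hψG (hf' w), neg_neg]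
  have i1 (w : Spacetime) : Integrable fun p => dirDeriv w (dirDeriv w ψ) p • f p :=
    integrable_smul_of_tsupport_subset hG
      (contDiff_dirDeriv (contDiff_dirDeriv hψ w) w).continuous
      (hasCompactSupport_dirDeriv (hasCompactSupport_dirDeriv hs w) w) (hsub' w) hf.continuousOn
  have i2 (w : Spacetime) : Integrable fun p => ψ p • dirDeriv w (dirDeriv w f) p :=
    integrable_smul_of_tsupport_subset hG hψ.continuous hs hψG
      (ContDiffOn.dirDeriv (m := 0) hG (hf' w) (by norm_num) w).continuousOn
  simp only [box_eq, sub_smul, smul_sub, Finset.sum_smul, Finset.smul_sum]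
  rw [integral_sub (integrable_finsetSum _ fun i _ => i1 _) (i1 _),
    integral_sub (integrable_finsetSum _ fun i _ => i2 _) (i2 _),
    integral_finsetSum _ fun i _ => i1 _, integral_finsetSum _ fun i _ => i2 _]
  simp only [key]

theorem continuous_box {ψ : Spacetime → ℝ} (hψ : ContDiff ℝ ∞ ψ) : Continuous (box ψ) :=
  continuousOn_univ.1 (continuousOn_box isOpen_univ (contDiff_infty.1 hψ 2).contDiffOn)

theorem tsupport_box_subset (ψ : Spacetime → ℝ) : tsupport (box ψ) ⊆ tsupport ψ := by
  refine closure_minimal (fun p hp => ?_) (isClosed_tsupport ψ)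
  by_contra h
  have key (w : Spacetime) : dirDeriv w (dirDeriv w ψ) p = 0 :=
    image_eq_zero_of_notMem_tsupport fun h' =>
      h (tsupport_dirDeriv_subset _ w (tsupport_dirDeriv_subset _ w h'))
  exact hp (by simp [box_eq, key])

theorem integrable_box_smul {ψ : Spacetime → ℝ} (hG : IsOpen G) (hψ : ContDiff ℝ ∞ ψ)
    (hs : HasCompactSupport ψ) (hψG : tsupport ψ ⊆ G) (hf : ContinuousOn f G) :
    Integrable fun p => box ψ p • f p :=
  integrable_smul_of_tsupport_subset hG (continuous_box hψ)
    (hs.of_isClosed_subset (isClosed_tsupport _) (tsupport_box_subset ψ))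
    ((tsupport_box_subset ψ).trans hψG) hf

/-- Directional derivatives of classical solutions of the wave equation are weak solutions. -/
theorem weakWaveOn_dirDeriv (hG : IsOpen G) (hf : ContDiffOn ℝ 2 f G)
    (hbox : ∀ p ∈ G, box f p = 0) (w : Spacetime) : WeakWaveOn G (dirDeriv w f) := by
  have hf' : ContDiffOn ℝ 1 (dirDeriv w f) G := ContDiffOn.dirDeriv hG hf (by norm_num) w
  refine ⟨hf'.continuousOn.locallyIntegrableOn hG.measurableSet, fun ψ hψ hs hψG => ?_⟩
  have hb : ContDiff ℝ ∞ (box ψ) := by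
    have h (w : Spacetime) := contDiff_dirDeriv (contDiff_dirDeriv hψ w) w
    exact (ContDiff.sum fun i _ => h _).sub (h _)
  have h1 := integral_dirDeriv_smul hG hb
    (hs.of_isClosed_subset (isClosed_tsupport _) (tsupport_box_subset ψ))
    ((tsupport_box_subset ψ).trans hψG) (hf.of_le (by norm_num)) w
  -- The derivative is thrown onto the test function, where it commutes with `box`. Thus `dirDeriv w
  -- ψ` becomes a test function for `f` itself, and `f` needs only two derivatives.
  have h2 : ∀ p, dirDeriv w (box ψ) p = box (dirDeriv w ψ) p := fun p =>
    (box_dirDeriv isOpen_univ (contDiff_infty.1 hψ 3).contDiffOn (Set.mem_univ p) w).symm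
  simp only [h2] at h1
  rw [integral_box_smul hG (contDiff_dirDeriv hψ w) (hasCompactSupport_dirDeriv hs w)
    ((tsupport_dirDeriv_subset ψ w).trans hψG) hf] at h1
  rw [← neg_eq_zero, ← h1]
  refine integral_eq_zero_of_ae (Filter.Eventually.of_forall fun p => ?_)
  by_cases hp : p ∈ G
  · simp [hbox p hp]
  · have : dirDeriv w ψ p = 0 := image_eq_zero_of_notMem_tsupport fun h' =>
      hp (hψG (tsupport_dirDeriv_subset ψ w h'))
    simp [this]

/-- Values off `G` do not matter, because `box ψ` vanishes there. -/
theorem WeakWaveOn.congr {g : Spacetime → F} (hG : IsOpen G) (hf : WeakWaveOn G f)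
    (h : Set.EqOn g f G) : WeakWaveOn G g := by
  refine ⟨hf.1.congr ?_, fun ψ hψ hs hψG => ?_⟩
  · exact ((ae_restrict_iff' hG.measurableSet).2 (Filter.Eventually.of_forall fun p hp => (h hp).symm))
  · rw [← hf.2 ψ hψ hs hψG]
    congr 1
    funext p
    by_cases hp : p ∈ G
    · rw [h hp]
    · rw [image_eq_zero_of_notMem_tsupport fun h' => hp (hψG (tsupport_box_subset ψ h')),
        zero_smul, zero_smul]

/-- A continuous field all of whose components are weak solutions is a weak solution. -/
theorem weakWaveOn_of_components {A : Spacetime → R3} (hG : IsOpen G) (hA : ContinuousOn A G)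
    (h : ∀ i, WeakWaveOn G fun p => A p i) : WeakWaveOn G A := by
  refine ⟨hA.locallyIntegrableOn hG.measurableSet, fun ψ hψ hs hψG => ?_⟩
  have hint := integrable_box_smul hG hψ hs hψG hA
  ext i
  have := (EuclideanSpace.proj i : R3 →L[ℝ] ℝ).integral_comp_comm hint
  simp only [PiLp.proj_apply, PiLp.smul_apply] at this
  rw [← this]
  exact (h i).2 ψ hψ hs hψG

theorem WeakWaveOn.sub {f g : Spacetime → F} (hG : IsOpen G) (hfc : ContinuousOn f G)
    (hgc : ContinuousOn g G) (hf : WeakWaveOn G f) (hg : WeakWaveOn G g) :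
    WeakWaveOn G fun p => f p - g p := by
  refine ⟨hf.1.sub hg.1, fun ψ hψ hs hψG => ?_⟩
  simp only [smul_sub]
  rw [integral_sub (integrable_box_smul hG hψ hs hψG hfc)
    (integrable_box_smul hG hψ hs hψG hgc), hf.2 ψ hψ hs hψG, hg.2 ψ hψ hs hψG, sub_zero]

theorem WeakWaveOn.neg {f : Spacetime → F} (hf : WeakWaveOn G f) :
    WeakWaveOn G fun p => -f p := by
  refine ⟨hf.1.neg, fun ψ hψ hs hψG => ?_⟩
  simp only [smul_neg]
  rw [integral_neg, hf.2 ψ hψ hs hψG, neg_zero]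

/-- Weak solutions of class `C²` are classical solutions. -/
theorem WeakWaveOn.box_eq_zero [CompleteSpace F] {U : Set Spacetime} (hf : WeakWaveOn G f)
    (hU : IsOpen U) (hUG : U ⊆ G) (hfU : ContDiffOn ℝ 2 f U) {p : Spacetime} (hp : p ∈ U) :
    box f p = 0 := by
  have hc := continuousOn_box hU hfU
  -- On `U` both derivatives can be moved back to `f`, so `box f` integrates to zero against every
  -- test function and vanishes almost everywhere; its continuity then gives the result everywhere
  -- on `U`.
  have h := hU.ae_eq_zero_of_integral_contDiff_smul_eq_zero
    (μ := (volume : Measure Spacetime)) (hc.locallyIntegrableOn hU.measurableSet)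
    fun ψ hψ hs hψU => by
      rw [← integral_box_smul hU hψ hs hψU hfU]
      exact hf.2 ψ hψ hs (hψU.trans hUG)
  exact Measure.eqOn_open_of_ae_eq ((ae_restrict_iff' hU.measurableSet).2 h) hU hc
    continuousOn_const hp

end Weak

/-! ### The light cone map and its derivative. -/

theorem hasFDerivAt_norm_of_ne_zero {y : R3} (hy : y ≠ 0) :
    HasFDerivAt (fun x : R3 => ‖x‖) (‖y‖⁻¹ • innerSL ℝ y) y := by
  have h := ((hasStrictFDerivAt_norm_sq y).hasFDerivAt).sqrt (by positivity)
  simp only [Real.sqrt_sq (norm_nonneg _)] at h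
  convert! h using 1
  ext w
  have : ‖y‖ ≠ 0 := norm_ne_zero_iff.2 hy
  simp
  field_simp

/-- The map `(x, s) ↦ (x, s + |x - r₂(s)|)`, a right inverse of which is `p ↦ (p.1, τ p)`. -/
def lightConeMap (r₂ : ℝ → R3) (q : Spacetime) : Spacetime := (q.1, q.2 + ‖q.1 - r₂ q.2‖)

/-- The derivative of `lightConeMap`. -/
def lightConeEquiv (e v : R3) (h : 1 - inner ℝ e v ≠ 0) : Spacetime ≃L[ℝ] Spacetime :=
  ContinuousLinearEquiv.equivOfInverse
    ((ContinuousLinearMap.fst ℝ R3 ℝ).prod (ContinuousLinearMap.snd ℝ R3 ℝ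
      + innerSL ℝ e ∘L (ContinuousLinearMap.fst ℝ R3 ℝ
        - (ContinuousLinearMap.snd ℝ R3 ℝ).smulRight v)))
    -- The inverse comes from solving η = σ + ⟨e, ξ - σv⟩ for σ, which gives σ = (η - ⟨e, ξ⟩)/(1 -
    -- ⟨e, v⟩).
    ((ContinuousLinearMap.fst ℝ R3 ℝ).prod ((1 / (1 - inner ℝ e v)) •
      (ContinuousLinearMap.snd ℝ R3 ℝ - innerSL ℝ e ∘L ContinuousLinearMap.fst ℝ R3 ℝ)))
    (fun q => by
      refine Prod.ext rfl ?_
      simp only [ContinuousLinearMap.prod_apply, ContinuousLinearMap.coe_fst', add_apply,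
        ContinuousLinearMap.coe_snd', ContinuousLinearMap.coe_comp, Function.comp_apply,
        sub_apply, ContinuousLinearMap.smulRight_apply, coe_innerSL_apply, smul_apply,
        smul_eq_mul, inner_sub_right, inner_smul_right]
      field_simp
      ring)
    (fun q => by
      refine Prod.ext rfl ?_
      simp only [ContinuousLinearMap.prod_apply, ContinuousLinearMap.coe_fst', add_apply,
        ContinuousLinearMap.coe_snd', ContinuousLinearMap.coe_comp, Function.comp_apply,
        sub_apply, ContinuousLinearMap.smulRight_apply, coe_innerSL_apply, smul_apply,
        smul_eq_mul, inner_sub_right, inner_smul_right]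
      field_simp
      ring)

/-! ### Smoothness and first derivatives of the fundamental fields. -/

section Fields

variable {m₀ : ℝ} {r₂ : ℝ → R3} {p : Spacetime}

theorem r12_ne_zero (hm : 0 < m₀) (hr : IsAdmissible m₀ r₂) (hp : p ∈ offPath r₂) :
    r12 r₂ p ≠ 0 := by
  rw [← norm_pos_iff, ← delay_eq_norm hm hr]
  exact (mem_offPath_iff hm hr p).1 hp

theorem hasFDerivAt_lightConeMap (hm : 0 < m₀) (hr : IsAdmissible m₀ r₂)
    (hp : p ∈ offPath r₂) :
    HasFDerivAt (lightConeMap r₂)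
      (lightConeEquiv (eField r₂ p) (vel r₂ p) (one_sub_inner_pos hm hr p).ne' :
        Spacetime →L[ℝ] Spacetime) (p.1, tau r₂ p) := by
  have h1 : HasFDerivAt (fun q : Spacetime => q.1 - r₂ q.2)
      (ContinuousLinearMap.fst ℝ R3 ℝ - (ContinuousLinearMap.snd ℝ R3 ℝ).smulRight (vel r₂ p))
      (p.1, tau r₂ p) := by
    have hd : HasDerivAt r₂ (vel r₂ p) (tau r₂ p) := (hr.differentiable _).hasDerivAt
    have h2 : HasFDerivAt (fun q : Spacetime => r₂ q.2)
        ((ContinuousLinearMap.snd ℝ R3 ℝ).smulRight (vel r₂ p)) (p.1, tau r₂ p) := by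
      convert! hd.hasFDerivAt.comp (p.1, tau r₂ p)
        (hasFDerivAt_snd (𝕜 := ℝ) (E := R3) (F := ℝ) (p := (p.1, tau r₂ p))) using 1
    exact hasFDerivAt_fst.fun_sub h2
  have h0 : HasFDerivAt (fun x : R3 => ‖x‖) _ (p.1 - r₂ (p.1, tau r₂ p).2) :=
    hasFDerivAt_norm_of_ne_zero (r12_ne_zero hm hr hp)
  have h2 := h0.comp (p.1, tau r₂ p) h1
  convert! hasFDerivAt_fst.prodMk (hasFDerivAt_snd.fun_add h2) using 1
  refine ContinuousLinearMap.ext fun q => Prod.ext rfl ?_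
  -- Writing the delay as a norm identifies `eField` with the unit vector produced by
  -- differentiating the norm.
  simp only [lightConeEquiv, eField, uField, delay_eq_norm hm hr, r12]
  simp [inner_smul_left, inner_sub_left]

theorem contDiffAt_lightConeMap {n : ℕ∞ω} (hn : ContDiff ℝ n r₂) (hm : 0 < m₀)
    (hr : IsAdmissible m₀ r₂) (hp : p ∈ offPath r₂) :
    ContDiffAt ℝ n (lightConeMap r₂) (p.1, tau r₂ p) := by
  have h1 : ContDiffAt ℝ n (fun q : Spacetime => q.1 - r₂ q.2) (p.1, tau r₂ p) :=
    (contDiff_fst.sub (hn.comp contDiff_snd)).contDiffAt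
  exact contDiffAt_fst.prodMk (contDiffAt_snd.add (h1.norm ℝ (r12_ne_zero hm hr hp)))

theorem lightConeMap_tau (hm : 0 < m₀) (hr : IsAdmissible m₀ r₂) (p : Spacetime) :
    lightConeMap r₂ (p.1, tau r₂ p) = p := by
  have := (isRetardedTime_tau hm hr p).2
  refine Prod.ext rfl ?_
  simp only [lightConeMap]
  linarith

/-- The time component of any preimage of `p` is a retarded time for `p`, so uniqueness applies.
This is what identifies `tau` with an abstract local inverse. -/
theorem eq_tau_of_lightConeMap_eq (hm : 0 < m₀) (hr : IsAdmissible m₀ r₂) {p q : Spacetime}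
    (h : lightConeMap r₂ q = p) : tau r₂ p = q.2 := by
  refine (existsUnique_isRetardedTime hm hr p).unique (isRetardedTime_tau hm hr p) ?_
  subst h
  refine ⟨?_, ?_⟩
  · simp [lightConeMap]
  · simp [lightConeMap]

/-- Inverse function theorem for `lightConeMap`: near `p`, `tau` is the time component of the local
inverse, so it inherits both the derivative and the class of r₂. -/
theorem hasFDerivAt_contDiffAt_tau {n : ℕ∞ω} (hn0 : n ≠ 0) (hn : ContDiff ℝ n r₂) (hm : 0 < m₀)
    (hr : IsAdmissible m₀ r₂) (hp : p ∈ offPath r₂) :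
    HasFDerivAt (tau r₂) (zField r₂ p • (ContinuousLinearMap.snd ℝ R3 ℝ
      - innerSL ℝ (eField r₂ p) ∘L ContinuousLinearMap.fst ℝ R3 ℝ)) p ∧
    ContDiffAt ℝ n (tau r₂) p := by
  have h1 := hasFDerivAt_lightConeMap hm hr hp
  have h2 := contDiffAt_lightConeMap hn hm hr hp
  have h3 := (h2.hasStrictFDerivAt' h1 hn0).to_localInverse
  have h4 := (h2.hasStrictFDerivAt' h1 hn0).eventually_right_inverse
  have h5 := h2.to_localInverse h1 hn0
  rw [lightConeMap_tau hm hr] at h3 h4 h5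
  have h6 : tau r₂ =ᶠ[𝓝 p] fun q => (h2.localInverse h1 hn0 q).2 := by
    filter_upwards [h4] with q hq
    exact eq_tau_of_lightConeMap_eq hm hr hq
  refine ⟨?_, (contDiff_snd.contDiffAt.comp p h5).congr_of_eventuallyEq h6⟩
  exact (h3.hasFDerivAt.snd).congr_of_eventuallyEq h6

theorem hasFDerivAt_tau (hm : 0 < m₀) (hr : IsAdmissible m₀ r₂) (hp : p ∈ offPath r₂) :
    HasFDerivAt (tau r₂) (zField r₂ p • (ContinuousLinearMap.snd ℝ R3 ℝ
      - innerSL ℝ (eField r₂ p) ∘L ContinuousLinearMap.fst ℝ R3 ℝ)) p :=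
  (hasFDerivAt_contDiffAt_tau (by simp) hr.contDiff hm hr hp).1

theorem contDiffOn_tau {n : ℕ∞ω} (hn0 : n ≠ 0) (hn : ContDiff ℝ n r₂) (hm : 0 < m₀)
    (hr : IsAdmissible m₀ r₂) : ContDiffOn ℝ n (tau r₂) (offPath r₂) := fun _ hp =>
  (hasFDerivAt_contDiffAt_tau hn0 hn hm hr hp).2.contDiffWithinAt

theorem contDiffOn_uField {n : ℕ∞ω} (hn0 : n ≠ 0) (hn : ContDiff ℝ n r₂) (hm : 0 < m₀)
    (hr : IsAdmissible m₀ r₂) : ContDiffOn ℝ n (uField r₂) (offPath r₂) :=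
  contDiffOn_const.div (contDiffOn_snd.sub (contDiffOn_tau hn0 hn hm hr)) fun p hp =>
    ((mem_offPath_iff hm hr p).1 hp).ne'

theorem contDiffOn_eField {n : ℕ∞ω} (hn0 : n ≠ 0) (hn : ContDiff ℝ n r₂) (hm : 0 < m₀)
    (hr : IsAdmissible m₀ r₂) : ContDiffOn ℝ n (eField r₂) (offPath r₂) :=
  (contDiffOn_uField hn0 hn hm hr).smul
    (contDiffOn_fst.sub (hn.comp_contDiffOn (contDiffOn_tau hn0 hn hm hr)))

theorem contDiffOn_vel {n : ℕ∞ω} (hn0 : n ≠ 0) (hn : ContDiff ℝ (n + 1) r₂) (hm : 0 < m₀)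
    (hr : IsAdmissible m₀ r₂) : ContDiffOn ℝ n (vel r₂) (offPath r₂) :=
  (contDiff_succ_iff_deriv.1 hn).2.2.comp_contDiffOn (contDiffOn_tau hn0 (hn.of_le le_self_add) hm hr)

theorem contDiffOn_acc {n : ℕ∞ω} (hn0 : n ≠ 0) (hn : ContDiff ℝ (n + 1 + 1) r₂) (hm : 0 < m₀)
    (hr : IsAdmissible m₀ r₂) : ContDiffOn ℝ n (acc r₂) (offPath r₂) :=
  (contDiff_succ_iff_deriv.1 (contDiff_succ_iff_deriv.1 hn).2.2).2.2.comp_contDiffOn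
    (contDiffOn_tau hn0 (hn.of_le (le_self_add.trans le_self_add)) hm hr)

theorem contDiffOn_zField {n : ℕ∞ω} (hn0 : n ≠ 0) (hn : ContDiff ℝ (n + 1) r₂) (hm : 0 < m₀)
    (hr : IsAdmissible m₀ r₂) : ContDiffOn ℝ n (zField r₂) (offPath r₂) :=
  contDiffOn_const.div (contDiffOn_const.sub
    ((contDiffOn_eField hn0 (hn.of_le le_self_add) hm hr).inner ℝ (contDiffOn_vel hn0 hn hm hr)))
    fun p _ => (one_sub_inner_pos hm hr p).ne'

theorem norm_eField (hm : 0 < m₀) (hr : IsAdmissible m₀ r₂) (hp : p ∈ offPath r₂) :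
    ‖eField r₂ p‖ = 1 := by
  have := norm_pos_iff.2 (r12_ne_zero hm hr hp)
  rw [eField, uField, delay_eq_norm hm hr, norm_smul, norm_div, norm_one, norm_norm]
  field_simp

theorem zField_mul (hm : 0 < m₀) (hr : IsAdmissible m₀ r₂) (p : Spacetime) :
    zField r₂ p * (1 - inner ℝ (eField r₂ p) (vel r₂ p)) = 1 :=
  one_div_mul_cancel (one_sub_inner_pos hm hr p).ne'

theorem uField_pos (hm : 0 < m₀) (hr : IsAdmissible m₀ r₂) (hp : p ∈ offPath r₂) :
    0 < uField r₂ p :=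
  one_div_pos.2 ((mem_offPath_iff hm hr p).1 hp)

theorem dirDeriv_tau (hm : 0 < m₀) (hr : IsAdmissible m₀ r₂) (hp : p ∈ offPath r₂)
    (w : Spacetime) :
    dirDeriv w (tau r₂) p = zField r₂ p * (w.2 - inner ℝ (eField r₂ p) w.1) := by
  rw [dirDeriv_of_hasFDerivAt (hasFDerivAt_tau hm hr hp)]
  simp

theorem dirDeriv_comp_tau {F : Type*} [NormedAddCommGroup F] [NormedSpace ℝ F] {f : ℝ → F}
    (hm : 0 < m₀) (hr : IsAdmissible m₀ r₂) (hp : p ∈ offPath r₂)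
    (hf : DifferentiableAt ℝ f (tau r₂ p)) (w : Spacetime) :
    dirDeriv w (fun q => f (tau r₂ q)) p = dirDeriv w (tau r₂) p • deriv f (tau r₂ p) := by
  have h := hasFDerivAt_tau hm hr hp
  have h' := dirDeriv_of_hasFDerivAt (hf.hasDerivAt.hasFDerivAt.comp p h) w
  rw [dirDeriv_of_hasFDerivAt h]
  exact h'.trans (by simp; module)

theorem dirDeriv_vel (hm : 0 < m₀) (hr : IsAdmissible m₀ r₂) (hp : p ∈ offPath r₂)
    (w : Spacetime) :
    dirDeriv w (vel r₂) p = dirDeriv w (tau r₂) p • acc r₂ p :=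
  dirDeriv_comp_tau hm hr hp ((hr.contDiff.iterate_deriv' 2 1).differentiable (by simp) _) w

theorem dirDeriv_uField (hm : 0 < m₀) (hr : IsAdmissible m₀ r₂) (hp : p ∈ offPath r₂)
    (w : Spacetime) :
    dirDeriv w (uField r₂) p = -(uField r₂ p) ^ 2 * (w.2 - dirDeriv w (tau r₂) p) := by
  have h := hasFDerivAt_tau hm hr hp
  have hT : delay r₂ p ≠ 0 := ((mem_offPath_iff hm hr p).1 hp).ne'
  have hd : HasFDerivAt (delay r₂) _ p :=
    (hasFDerivAt_snd (𝕜 := ℝ) (E := R3) (F := ℝ) (p := p)).fun_sub h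
  have hu := ((hasDerivAt_inv hT).hasFDerivAt.comp p hd).congr_of_eventuallyEq
    (f₁ := uField r₂) (Filter.Eventually.of_forall fun q => one_div _)
  rw [dirDeriv_of_hasFDerivAt h, dirDeriv_of_hasFDerivAt hu]
  simp [uField]
  ring

theorem dirDeriv_eField (hm : 0 < m₀) (hr : IsAdmissible m₀ r₂) (hp : p ∈ offPath r₂)
    (w : Spacetime) :
    dirDeriv w (eField r₂) p =
      -(uField r₂ p * (w.2 - dirDeriv w (tau r₂) p)) • eField r₂ p
        + uField r₂ p • (w.1 - dirDeriv w (tau r₂) p • vel r₂ p) := by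
  have h := hasFDerivAt_tau hm hr hp
  have hu : DifferentiableAt ℝ (uField r₂) p :=
    differentiableAt_of_contDiffOn (isOpen_offPath hr)
      (contDiffOn_uField (n := 3) (by simp) hr.contDiff hm hr) (by simp) hp
  have hd : HasDerivAt r₂ (vel r₂ p) (tau r₂ p) := (hr.differentiable _).hasDerivAt
  have hx : HasFDerivAt (r12 r₂) _ p :=
    (hasFDerivAt_fst (𝕜 := ℝ) (E := R3) (F := ℝ) (p := p)).fun_sub (hd.hasFDerivAt.comp p h)
  have : eField r₂ = fun q => uField r₂ q • r12 r₂ q := rfl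
  rw [this, dirDeriv_smul hu hx.differentiableAt, dirDeriv_uField hm hr hp,
    dirDeriv_of_hasFDerivAt hx, dirDeriv_of_hasFDerivAt h]
  simp
  module

theorem dirDeriv_zField (hm : 0 < m₀) (hr : IsAdmissible m₀ r₂) (hp : p ∈ offPath r₂)
    (w : Spacetime) :
    dirDeriv w (zField r₂) p = (zField r₂ p) ^ 2 *
      (inner ℝ (dirDeriv w (eField r₂) p) (vel r₂ p)
        + dirDeriv w (tau r₂) p * inner ℝ (eField r₂ p) (acc r₂ p)) := by
  have hG := isOpen_offPath hr
  have he : DifferentiableAt ℝ (eField r₂) p :=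
    differentiableAt_of_contDiffOn hG
      (contDiffOn_eField (n := 3) (by simp) hr.contDiff hm hr) (by simp) hp
  have hv : DifferentiableAt ℝ (vel r₂) p :=
    differentiableAt_of_contDiffOn hG
      (contDiffOn_vel (n := 2) (by simp) hr.contDiff hm hr) (by simp) hp
  have hd := (hasFDerivAt_const (1 : ℝ) p).fun_sub (he.hasFDerivAt.inner ℝ hv.hasFDerivAt)
  have hz := ((hasDerivAt_inv
    (one_sub_inner_pos hm hr p).ne').hasFDerivAt.comp p hd).congr_of_eventuallyEq
    (f₁ := zField r₂) (Filter.Eventually.of_forall fun q => one_div _)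
  have hv' := dirDeriv_vel hm hr hp w
  rw [dirDeriv_eq_fderiv hv] at hv'
  rw [dirDeriv_of_hasFDerivAt hz, dirDeriv_eq_fderiv he]
  simp [zField, hv', inner_smul_right]
  ring

end Fields

/-! ### Maxwell's equations and weak wave equations from abstract potentials. -/

section Potentials

variable {G : Set Spacetime} {φ : Spacetime → ℝ} {A E B : Spacetime → R3} {p : Spacetime}

theorem contDiffOn_component {n : ℕ∞ω} (hA : ContDiffOn ℝ n A G) (i : Fin 3) :
    ContDiffOn ℝ n (fun q => A q i) G :=
  (EuclideanSpace.proj i : R3 →L[ℝ] ℝ).contDiff.comp_contDiffOn hA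

theorem dirDeriv_dirDeriv_apply (hG : IsOpen G) (hA : ContDiffOn ℝ 2 A G) (hp : p ∈ G)
    (w w' : Spacetime) (i : Fin 3) :
    dirDeriv w (dirDeriv w' fun q => A q i) p = dirDeriv w (dirDeriv w' A) p i := by
  rw [dirDeriv_congr hG (fun q hq => dirDeriv_apply
      (differentiableAt_of_contDiffOn hG hA (by simp) hq) w' i) hp]
  exact dirDeriv_apply (differentiableAt_of_contDiffOn hG
    (ContDiffOn.dirDeriv (m := 1) hG hA (by norm_num) w') (by simp) hp) w i

theorem box_apply (hG : IsOpen G) (hA : ContDiffOn ℝ 2 A G) (hp : p ∈ G) (i : Fin 3) :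
    box (fun q => A q i) p = box A p i := by
  simp [box_eq, dirDeriv_dirDeriv_apply hG hA hp, Fin.sum_univ_three]

theorem electric_component (hG : IsOpen G) (hA : ContDiffOn ℝ 2 A G)
    (hE : ∀ p ∈ G, E p = -grad φ p - partialT A p) (i : Fin 3) :
    Set.EqOn (fun q => E q i)
      (fun q => -dirDeriv (basisX i) φ q - dirDeriv basisT (fun q => A q i) q) G := by
  intro q hq
  dsimp only
  rw [hE q hq, dirDeriv_apply (differentiableAt_of_contDiffOn hG hA (by simp) hq)]
  rfl

theorem dirDeriv_electric_component (hG : IsOpen G) (hφ : ContDiffOn ℝ 2 φ G)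
    (hA : ContDiffOn ℝ 2 A G) (hE : ∀ p ∈ G, E p = -grad φ p - partialT A p) (hp : p ∈ G)
    (w : Spacetime) (i : Fin 3) :
    dirDeriv w (fun q => E q i) p = -dirDeriv w (dirDeriv (basisX i) φ) p
      - dirDeriv w (dirDeriv basisT fun q => A q i) p := by
  have h1 := differentiableAt_of_contDiffOn hG
    (ContDiffOn.dirDeriv (m := 1) hG hφ (by norm_num) (basisX i)) (by simp) hp
  have h2 := differentiableAt_of_contDiffOn hG
    (ContDiffOn.dirDeriv (m := 1) hG (contDiffOn_component hA i) (by norm_num) basisT) (by simp) hp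
  rw [dirDeriv_congr hG (electric_component hG hA hE i) hp, dirDeriv_sub h1.fun_neg h2,
    dirDeriv_neg h1]

/-- The component `D_i A_j - D_j A_i` of the curl. -/
theorem dirDeriv_sub_component (hG : IsOpen G) (hA : ContDiffOn ℝ 2 A G) (hp : p ∈ G)
    (w : Spacetime) (i j : Fin 3) :
    dirDeriv w (fun q => dirDeriv (basisX i) (fun q => A q j) q
        - dirDeriv (basisX j) (fun q => A q i) q) p
      = dirDeriv w (dirDeriv (basisX i) fun q => A q j) p
        - dirDeriv w (dirDeriv (basisX j) fun q => A q i) p :=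
  dirDeriv_sub
    (differentiableAt_of_contDiffOn hG (ContDiffOn.dirDeriv (m := 1) hG
      (contDiffOn_component hA j) (by norm_num) (basisX i)) (by simp) hp)
    (differentiableAt_of_contDiffOn hG (ContDiffOn.dirDeriv (m := 1) hG
      (contDiffOn_component hA i) (by norm_num) (basisX j)) (by simp) hp) w

theorem magnetic_component_zero (hB : ∀ p ∈ G, B p = curl A p) :
    Set.EqOn (fun q => B q 0) (fun q => dirDeriv (basisX 1) (fun q => A q 2) q
        - dirDeriv (basisX 2) (fun q => A q 1) q) G := fun q hq => by
  dsimp only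
  rw [hB q hq]
  rfl

theorem magnetic_component_one (hB : ∀ p ∈ G, B p = curl A p) :
    Set.EqOn (fun q => B q 1) (fun q => dirDeriv (basisX 2) (fun q => A q 0) q
        - dirDeriv (basisX 0) (fun q => A q 2) q) G := fun q hq => by
  dsimp only
  rw [hB q hq]
  rfl

theorem magnetic_component_two (hB : ∀ p ∈ G, B p = curl A p) :
    Set.EqOn (fun q => B q 2) (fun q => dirDeriv (basisX 0) (fun q => A q 1) q
        - dirDeriv (basisX 1) (fun q => A q 0) q) G := fun q hq => by
  dsimp only
  rw [hB q hq]
  rfl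

/-- Potentials in the Lorenz gauge that satisfy the wave equation generate a solution of the
homogeneous Maxwell equations. -/
theorem maxwell_of_potentials (hG : IsOpen G) (hφ : ContDiffOn ℝ 2 φ G) (hA : ContDiffOn ℝ 2 A G)
    (hE1 : ContDiffOn ℝ 1 E G) (hB1 : ContDiffOn ℝ 1 B G)
    (hE : ∀ p ∈ G, E p = -grad φ p - partialT A p) (hB : ∀ p ∈ G, B p = curl A p)
    (hboxφ : ∀ p ∈ G, box φ p = 0) (hboxA : ∀ p ∈ G, box A p = 0)
    (hgauge : ∀ p ∈ G, div A p + partialT φ p = 0) (hp : p ∈ G) :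
    curl E p = -partialT B p ∧ div E p = 0 ∧ curl B p = partialT E p ∧ div B p = 0 := by
  have hEd : DifferentiableAt ℝ E p := differentiableAt_of_contDiffOn hG hE1 (by simp) hp
  have hBd : DifferentiableAt ℝ B p := differentiableAt_of_contDiffOn hG hB1 (by simp) hp
  have dE := dirDeriv_electric_component hG hφ hA hE hp
  have dB0 (w : Spacetime) := (dirDeriv_congr hG (magnetic_component_zero hB) hp w).trans
    (dirDeriv_sub_component hG hA hp w 1 2)
  have dB1 (w : Spacetime) := (dirDeriv_congr hG (magnetic_component_one hB) hp w).trans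
    (dirDeriv_sub_component hG hA hp w 2 0)
  have dB2 (w : Spacetime) := (dirDeriv_congr hG (magnetic_component_two hB) hp w).trans
    (dirDeriv_sub_component hG hA hp w 0 1)
  have cφ := dirDeriv_comm hG hφ hp
  have cA (i : Fin 3) := dirDeriv_comm hG (contDiffOn_component hA i) hp
  have wA (i : Fin 3) : (∑ j : Fin 3, dirDeriv (basisX j) (dirDeriv (basisX j) fun q => A q i) p)
      - dirDeriv basisT (dirDeriv basisT fun q => A q i) p = 0 := by
    rw [← box_eq, box_apply hG hA hp, hboxA p hp]
    rfl
  have wφ := hboxφ p hp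
  -- The gauge condition holds on the open set `G`, so it can be differentiated in any direction.
  have gA (w : Spacetime) : (∑ j : Fin 3, dirDeriv w (dirDeriv (basisX j) fun q => A q j) p)
      + dirDeriv w (dirDeriv basisT φ) p = 0 := by
    have h1 (j : Fin 3) : DifferentiableAt ℝ (dirDeriv (basisX j) fun q => A q j) p :=
      differentiableAt_of_contDiffOn hG (ContDiffOn.dirDeriv (m := 1) hG
        (contDiffOn_component hA j) (by norm_num) _) (by simp) hp
    have h2 : DifferentiableAt ℝ (dirDeriv basisT φ) p :=
      differentiableAt_of_contDiffOn hG (ContDiffOn.dirDeriv (m := 1) hG hφ (by norm_num) _)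
        (by simp) hp
    rw [← dirDeriv_sum _ fun j _ => h1 j, ← dirDeriv_add (DifferentiableAt.fun_sum fun j _ => h1 j) h2]
    have h0 : Set.EqOn (fun q => (∑ j : Fin 3, dirDeriv (basisX j) (fun q => A q j) q)
        + dirDeriv basisT φ q) (fun _ => 0) G := hgauge
    rw [dirDeriv_congr hG h0 hp, dirDeriv_of_hasFDerivAt (hasFDerivAt_const (0 : ℝ) p)]
    rfl
  have gT := gA basisT
  have g0 := gA (basisX 0)
  have g1 := gA (basisX 1)
  have g2 := gA (basisX 2)
  have w0 := wA 0
  have w1 := wA 1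
  have w2 := wA 2
  rw [box_eq] at wφ
  simp only [Fin.sum_univ_three] at gT g0 g1 g2 w0 w1 w2 wφ
  refine ⟨?_, ?_, ?_, ?_⟩
  · ext i
    rw [partialT_eq, PiLp.neg_apply, ← dirDeriv_apply hBd]
    fin_cases i
    · change dirDeriv (basisX 1) (fun q => E q 2) p - dirDeriv (basisX 2) (fun q => E q 1) p
        = -dirDeriv basisT (fun q => B q 0) p
      rw [dB0, dE, dE, cφ (basisX 1), cA 2 basisT, cA 1 basisT]
      ring
    · change dirDeriv (basisX 2) (fun q => E q 0) p - dirDeriv (basisX 0) (fun q => E q 2) p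
        = -dirDeriv basisT (fun q => B q 1) p
      rw [dB1, dE, dE, cφ (basisX 2), cA 0 basisT, cA 2 basisT]
      ring
    · change dirDeriv (basisX 0) (fun q => E q 1) p - dirDeriv (basisX 1) (fun q => E q 0) p
        = -dirDeriv basisT (fun q => B q 2) p
      rw [dB2, dE, dE, cφ (basisX 0), cA 1 basisT, cA 0 basisT]
      ring
  · simp only [div, partialX_eq, dE, Fin.sum_univ_three]
    rw [cA 0 (basisX 0), cA 1 (basisX 1), cA 2 (basisX 2)]
    -- Here ∇ · E = -∇²φ - D(∇ · A), and the time derivative of the gauge condition turns this into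
    -- -□²φ.
    linear_combination -gT - wφ
  · ext i
    rw [partialT_eq, ← dirDeriv_apply hEd]
    fin_cases i
    · change dirDeriv (basisX 1) (fun q => B q 2) p - dirDeriv (basisX 2) (fun q => B q 1) p
        = dirDeriv basisT (fun q => E q 0) p
      rw [dB1, dB2, dE, cφ basisT, cA 1 (basisX 1), cA 2 (basisX 2)]
      -- This is ∇ × (∇ × A) = ∇(∇ · A) - ∇²A by components: the gauge replaces ∇ · A by -Dφ, and
      -- the wave equation replaces ∇²A by D²A.
      linear_combination g0 - w0
    · change dirDeriv (basisX 2) (fun q => B q 0) p - dirDeriv (basisX 0) (fun q => B q 2) p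
        = dirDeriv basisT (fun q => E q 1) p
      rw [dB0, dB2, dE, cφ basisT, cA 2 (basisX 2), cA 0 (basisX 0)]
      linear_combination g1 - w1
    · change dirDeriv (basisX 0) (fun q => B q 1) p - dirDeriv (basisX 1) (fun q => B q 0) p
        = dirDeriv basisT (fun q => E q 2) p
      rw [dB0, dB1, dE, cφ basisT, cA 0 (basisX 0), cA 1 (basisX 1)]
      linear_combination g2 - w2
  · simp only [div, partialX_eq, Fin.sum_univ_three]
    rw [dB0, dB1, dB2, cA 2 (basisX 0), cA 1 (basisX 0), cA 0 (basisX 1)]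
    ring

theorem weakWaveOn_dirDeriv_component (hG : IsOpen G) (hA : ContDiffOn ℝ 2 A G)
    (hboxA : ∀ p ∈ G, box A p = 0) (i : Fin 3) (w : Spacetime) :
    WeakWaveOn G (dirDeriv w fun q => A q i) :=
  weakWaveOn_dirDeriv hG (contDiffOn_component hA i) (fun q hq => by
    rw [box_apply hG hA hq, hboxA q hq]
    rfl) w

theorem weakWaveOn_electric (hG : IsOpen G) (hφ : ContDiffOn ℝ 2 φ G) (hA : ContDiffOn ℝ 2 A G)
    (hE1 : ContDiffOn ℝ 1 E G) (hE : ∀ p ∈ G, E p = -grad φ p - partialT A p)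
    (hboxφ : ∀ p ∈ G, box φ p = 0) (hboxA : ∀ p ∈ G, box A p = 0) : WeakWaveOn G E := by
  refine weakWaveOn_of_components hG hE1.continuousOn fun i => ?_
  refine WeakWaveOn.congr hG (WeakWaveOn.sub hG ?_ ?_
    (weakWaveOn_dirDeriv hG hφ hboxφ (basisX i)).neg
    (weakWaveOn_dirDeriv_component hG hA hboxA i basisT)) (electric_component hG hA hE i)
  · exact (ContDiffOn.dirDeriv (m := 1) hG hφ (by norm_num) _).continuousOn.neg
  · exact (ContDiffOn.dirDeriv (m := 1) hG (contDiffOn_component hA i) (by norm_num) _).continuousOn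

theorem weakWaveOn_magnetic (hG : IsOpen G) (hA : ContDiffOn ℝ 2 A G)
    (hB1 : ContDiffOn ℝ 1 B G) (hB : ∀ p ∈ G, B p = curl A p)
    (hboxA : ∀ p ∈ G, box A p = 0) : WeakWaveOn G B := by
  have key (i j : Fin 3) : WeakWaveOn G fun q => dirDeriv (basisX i) (fun q => A q j) q
      - dirDeriv (basisX j) (fun q => A q i) q := by
    have hc (i j : Fin 3) : ContinuousOn (dirDeriv (basisX i) fun q => A q j) G :=
      (ContDiffOn.dirDeriv (m := 1) hG (contDiffOn_component hA j) (by norm_num) _).continuousOn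
    exact WeakWaveOn.sub hG (hc i j) (hc j i) (weakWaveOn_dirDeriv_component hG hA hboxA j _)
      (weakWaveOn_dirDeriv_component hG hA hboxA i _)
  refine weakWaveOn_of_components hG hB1.continuousOn fun i => ?_
  fin_cases i
  · exact WeakWaveOn.congr hG (key 1 2) (magnetic_component_zero hB)
  · exact WeakWaveOn.congr hG (key 2 0) (magnetic_component_one hB)
  · exact WeakWaveOn.congr hG (key 0 1) (magnetic_component_two hB)

end Potentials

/-! ### The explicit field and its Liénard–Wiechert potentials. -/

section Trajectory

variable {m₀ : ℝ} {r₂ : ℝ → R3} {p : Spacetime}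

theorem inner_eq_sum (x y : R3) : inner ℝ x y = x 0 * y 0 + x 1 * y 1 + x 2 * y 2 := by
  simp [PiLp.inner_apply, Fin.sum_univ_three]
  ring

theorem inner_basisX (x : R3) (i : Fin 3) : inner ℝ x (basisX i).1 = x i := by
  rw [inner_eq_sum]
  fin_cases i <;> simp [basisX]

theorem zField_mul_inner (hm : 0 < m₀) (hr : IsAdmissible m₀ r₂) (p : Spacetime) :
    zField r₂ p * inner ℝ (eField r₂ p) (vel r₂ p) = zField r₂ p - 1 := by
  linear_combination -zField_mul hm hr p

/-- Eliminating ⟨e, v⟩ through z⟨e, v⟩ = z - 1 puts the derivative in a normal form, so that many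
later identities reduce to `ring`. -/
theorem dirDeriv_zField_eq (hm : 0 < m₀) (hr : IsAdmissible m₀ r₂) (hp : p ∈ offPath r₂)
    (w : Spacetime) :
    dirDeriv w (zField r₂) p =
      -(uField r₂ p * zField r₂ p * (zField r₂ p - 1) * (w.2 - dirDeriv w (tau r₂) p))
      + uField r₂ p * zField r₂ p ^ 2 * (inner ℝ w.1 (vel r₂ p)
        - dirDeriv w (tau r₂) p * inner ℝ (vel r₂ p) (vel r₂ p))
      + zField r₂ p ^ 2 * dirDeriv w (tau r₂) p * inner ℝ (eField r₂ p) (acc r₂ p) := by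
  rw [dirDeriv_zField hm hr hp, dirDeriv_eField hm hr hp, inner_add_left, inner_smul_left,
    inner_smul_left, inner_sub_left, inner_smul_left]
  simp only [conj_trivial]
  linear_combination (-(zField r₂ p * uField r₂ p * (w.2 - dirDeriv w (tau r₂) p)))
    * zField_mul_inner hm hr p

theorem dirDeriv_basisT_tau (hm : 0 < m₀) (hr : IsAdmissible m₀ r₂) (hp : p ∈ offPath r₂) :
    dirDeriv basisT (tau r₂) p = zField r₂ p := by
  rw [dirDeriv_tau hm hr hp]
  simp [basisT]

theorem dirDeriv_basisX_tau (hm : 0 < m₀) (hr : IsAdmissible m₀ r₂) (hp : p ∈ offPath r₂)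
    (i : Fin 3) : dirDeriv (basisX i) (tau r₂) p = -(zField r₂ p * eField r₂ p i) := by
  rw [dirDeriv_tau hm hr hp, inner_basisX]
  simp only [basisX]
  ring

theorem dirDeriv_basisT_zField (hm : 0 < m₀) (hr : IsAdmissible m₀ r₂) (hp : p ∈ offPath r₂) :
    dirDeriv basisT (zField r₂) p = uField r₂ p * zField r₂ p * (1 - zField r₂ p) ^ 2
      - uField r₂ p * zField r₂ p ^ 3 * inner ℝ (vel r₂ p) (vel r₂ p)
      + zField r₂ p ^ 3 * inner ℝ (eField r₂ p) (acc r₂ p) := by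
  rw [dirDeriv_zField_eq hm hr hp, dirDeriv_basisT_tau hm hr hp]
  simp only [basisT, inner_zero_left]
  ring

theorem dirDeriv_basisX_zField (hm : 0 < m₀) (hr : IsAdmissible m₀ r₂) (hp : p ∈ offPath r₂)
    (i : Fin 3) :
    dirDeriv (basisX i) (zField r₂) p =
      -(uField r₂ p * zField r₂ p ^ 2 * (zField r₂ p - 1) * eField r₂ p i)
      + uField r₂ p * zField r₂ p ^ 2 * (vel r₂ p i
        + zField r₂ p * eField r₂ p i * inner ℝ (vel r₂ p) (vel r₂ p))
      - zField r₂ p ^ 3 * eField r₂ p i * inner ℝ (eField r₂ p) (acc r₂ p) := by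
  rw [dirDeriv_zField_eq hm hr hp, dirDeriv_basisX_tau hm hr hp]
  rw [real_inner_comm, inner_basisX]
  simp only [basisX]
  ring

theorem dirDeriv_basisT_uField (hm : 0 < m₀) (hr : IsAdmissible m₀ r₂) (hp : p ∈ offPath r₂) :
    dirDeriv basisT (uField r₂) p = -uField r₂ p ^ 2 * (1 - zField r₂ p) := by
  rw [dirDeriv_uField hm hr hp, dirDeriv_basisT_tau hm hr hp]
  rfl

theorem dirDeriv_basisX_uField (hm : 0 < m₀) (hr : IsAdmissible m₀ r₂) (hp : p ∈ offPath r₂)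
    (i : Fin 3) :
    dirDeriv (basisX i) (uField r₂) p = -uField r₂ p ^ 2 * (zField r₂ p * eField r₂ p i) := by
  rw [dirDeriv_uField hm hr hp, dirDeriv_basisX_tau hm hr hp]
  simp only [basisX]
  ring

theorem dirDeriv_basisT_eField (hm : 0 < m₀) (hr : IsAdmissible m₀ r₂) (hp : p ∈ offPath r₂) :
    dirDeriv basisT (eField r₂) p = -(uField r₂ p * (1 - zField r₂ p)) • eField r₂ p
      - (uField r₂ p * zField r₂ p) • vel r₂ p := by
  rw [dirDeriv_eField hm hr hp, dirDeriv_basisT_tau hm hr hp]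
  simp only [basisT]
  module

theorem dirDeriv_basisX_eField (hm : 0 < m₀) (hr : IsAdmissible m₀ r₂) (hp : p ∈ offPath r₂)
    (i : Fin 3) :
    dirDeriv (basisX i) (eField r₂) p i = -(uField r₂ p * zField r₂ p * eField r₂ p i ^ 2)
      + uField r₂ p * (1 + zField r₂ p * eField r₂ p i * vel r₂ p i) := by
  rw [dirDeriv_eField hm hr hp, dirDeriv_basisX_tau hm hr hp]
  simp [basisX]
  ring

theorem differentiableAt_uField (hm : 0 < m₀) (hr : IsAdmissible m₀ r₂) (hp : p ∈ offPath r₂) :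
    DifferentiableAt ℝ (uField r₂) p :=
  differentiableAt_of_contDiffOn (isOpen_offPath hr)
    (contDiffOn_uField (n := 3) (by simp) hr.contDiff hm hr) (by simp) hp

theorem differentiableAt_eField (hm : 0 < m₀) (hr : IsAdmissible m₀ r₂) (hp : p ∈ offPath r₂) :
    DifferentiableAt ℝ (eField r₂) p :=
  differentiableAt_of_contDiffOn (isOpen_offPath hr)
    (contDiffOn_eField (n := 3) (by simp) hr.contDiff hm hr) (by simp) hp

theorem differentiableAt_zField (hm : 0 < m₀) (hr : IsAdmissible m₀ r₂) (hp : p ∈ offPath r₂) :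
    DifferentiableAt ℝ (zField r₂) p :=
  differentiableAt_of_contDiffOn (isOpen_offPath hr)
    (contDiffOn_zField (n := 2) (by simp) hr.contDiff hm hr) (by simp) hp

theorem differentiableAt_vel (hm : 0 < m₀) (hr : IsAdmissible m₀ r₂) (hp : p ∈ offPath r₂) :
    DifferentiableAt ℝ (vel r₂) p :=
  differentiableAt_of_contDiffOn (isOpen_offPath hr)
    (contDiffOn_vel (n := 2) (by simp) hr.contDiff hm hr) (by simp) hp

theorem differentiableAt_acc (hm : 0 < m₀) (hr : IsAdmissible m₀ r₂) (hp : p ∈ offPath r₂) :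
    DifferentiableAt ℝ (acc r₂) p :=
  differentiableAt_of_contDiffOn (isOpen_offPath hr)
    (contDiffOn_acc (n := 1) (by simp) (hr.contDiff.of_le (by norm_num)) hm hr) (by simp) hp

theorem contDiffOn_scalarPot {n : ℕ∞ω} (hn0 : n ≠ 0) (hn : ContDiff ℝ (n + 1) r₂) (hm : 0 < m₀)
    (hr : IsAdmissible m₀ r₂) : ContDiffOn ℝ n (scalarPot r₂) (offPath r₂) :=
  (contDiffOn_uField hn0 (hn.of_le le_self_add) hm hr).mul (contDiffOn_zField hn0 hn hm hr)

theorem contDiffOn_vectorPot {n : ℕ∞ω} (hn0 : n ≠ 0) (hn : ContDiff ℝ (n + 1) r₂) (hm : 0 < m₀)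
    (hr : IsAdmissible m₀ r₂) : ContDiffOn ℝ n (vectorPot r₂) (offPath r₂) :=
  (contDiffOn_scalarPot hn0 hn hm hr).smul (contDiffOn_vel hn0 hn hm hr)

theorem differentiableAt_scalarPot (hm : 0 < m₀) (hr : IsAdmissible m₀ r₂)
    (hp : p ∈ offPath r₂) : DifferentiableAt ℝ (scalarPot r₂) p :=
  (differentiableAt_uField hm hr hp).mul (differentiableAt_zField hm hr hp)

theorem dirDeriv_dirDeriv_eField (hm : 0 < m₀) (hr : IsAdmissible m₀ r₂) (hp : p ∈ offPath r₂) :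
    dirDeriv basisT (dirDeriv basisT (eField r₂)) p =
      -((dirDeriv basisT (uField r₂) p * (1 - zField r₂ p)
        - uField r₂ p * dirDeriv basisT (zField r₂) p)) • eField r₂ p
      - (uField r₂ p * (1 - zField r₂ p)) • dirDeriv basisT (eField r₂) p
      - (dirDeriv basisT (uField r₂) p * zField r₂ p
        + uField r₂ p * dirDeriv basisT (zField r₂) p) • vel r₂ p
      - (uField r₂ p * zField r₂ p ^ 2) • acc r₂ p := by
  have hu := differentiableAt_uField hm hr hp
  have he := differentiableAt_eField hm hr hp
  have hz := differentiableAt_zField hm hr hp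
  have hv := differentiableAt_vel hm hr hp
  have h1 : DifferentiableAt ℝ (fun q => 1 - zField r₂ q) p := hz.const_sub 1
  have h2 : dirDeriv basisT (fun q => 1 - zField r₂ q) p = -dirDeriv basisT (zField r₂) p := by
    rw [dirDeriv_sub (differentiableAt_const _) hz,
      dirDeriv_of_hasFDerivAt (hasFDerivAt_const (1 : ℝ) p)]
    simp
  rw [dirDeriv_congr (isOpen_offPath hr) (fun q hq => dirDeriv_basisT_eField hm hr hq) hp,
    dirDeriv_sub ((hu.fun_mul h1).fun_neg.fun_smul he) ((hu.fun_mul hz).fun_smul hv),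
    dirDeriv_smul (hu.fun_mul h1).fun_neg he, dirDeriv_smul (hu.fun_mul hz) hv,
    dirDeriv_neg (hu.fun_mul h1), dirDeriv_mul hu h1, dirDeriv_mul hu hz, h2,
    dirDeriv_vel hm hr hp, dirDeriv_basisT_tau hm hr hp]
  module

theorem elec_eq (hm : 0 < m₀) (hr : IsAdmissible m₀ r₂) (hp : p ∈ offPath r₂) :
    elec r₂ p =
      -(uField r₂ p * zField r₂ p ^ 2) • acc r₂ p
      + (uField r₂ p * zField r₂ p ^ 3 * inner ℝ (eField r₂ p) (acc r₂ p)) • eField r₂ p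
      - (uField r₂ p * zField r₂ p ^ 3 * inner ℝ (eField r₂ p) (acc r₂ p)) • vel r₂ p
      + (uField r₂ p ^ 2 * zField r₂ p ^ 3) • eField r₂ p
      - (uField r₂ p ^ 2 * zField r₂ p ^ 3 * inner ℝ (vel r₂ p) (vel r₂ p)) • eField r₂ p
      - (uField r₂ p ^ 2 * zField r₂ p ^ 3) • vel r₂ p
      + (uField r₂ p ^ 2 * zField r₂ p ^ 3 * inner ℝ (vel r₂ p) (vel r₂ p)) • vel r₂ p := by
  have hu := differentiableAt_uField hm hr hp
  have he := differentiableAt_eField hm hr hp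
  have hu0 := (uField_pos hm hr hp).ne'
  -- A factor u is pulled out to cancel the u⁻¹ in the definition of E.
  have h1 : dirDeriv basisT (fun q => uField r₂ q ^ 2 • eField r₂ q) p =
      uField r₂ p • (uField r₂ p • dirDeriv basisT (eField r₂) p
        + (2 * dirDeriv basisT (uField r₂) p) • eField r₂ p) := by
    simp only [pow_two]
    rw [dirDeriv_smul (hu.fun_mul hu) he, dirDeriv_mul hu hu]
    module
  simp only [elec, partialT_eq]
  rw [h1, inv_smul_smul₀ hu0, dirDeriv_dirDeriv_eField hm hr hp,
    dirDeriv_basisT_eField hm hr hp, dirDeriv_basisT_uField hm hr hp,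
    dirDeriv_basisT_zField hm hr hp]
  module

/-- By the explicit formula E involves no derivative of r₂ beyond the acceleration, so only two
orders of smoothness are lost. -/
theorem contDiffOn_elec {n : ℕ∞ω} (hn0 : n ≠ 0) (hn : ContDiff ℝ (n + 1 + 1) r₂) (hm : 0 < m₀)
    (hr : IsAdmissible m₀ r₂) : ContDiffOn ℝ n (elec r₂) (offPath r₂) := by
  have hn1 : ContDiff ℝ (n + 1) r₂ := hn.of_le le_self_add
  have hu := contDiffOn_uField hn0 (hn1.of_le le_self_add) hm hr
  have he := contDiffOn_eField hn0 (hn1.of_le le_self_add) hm hr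
  have hz := contDiffOn_zField hn0 hn1 hm hr
  have hv := contDiffOn_vel hn0 hn1 hm hr
  have ha := contDiffOn_acc hn0 hn hm hr
  have hea := he.inner ℝ ha
  have hvv := hv.inner ℝ hv
  have h3 := hu.mul (hz.pow 3)
  have h23 := (hu.pow 2).mul (hz.pow 3)
  refine ContDiffOn.congr ?_ fun q hq => elec_eq hm hr hq
  exact ((((((((hu.mul (hz.pow 2)).neg.smul ha).add ((h3.mul hea).smul he)).sub
    ((h3.mul hea).smul hv)).add (h23.smul he)).sub ((h23.mul hvv).smul he)).sub
    (h23.smul hv)).add ((h23.mul hvv).smul hv))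

theorem contDiffOn_magn {n : ℕ∞ω} (hn0 : n ≠ 0) (hn : ContDiff ℝ (n + 1 + 1) r₂) (hm : 0 < m₀)
    (hr : IsAdmissible m₀ r₂) : ContDiffOn ℝ n (magn r₂) (offPath r₂) := by
  have he (i : Fin 3) := contDiffOn_component (contDiffOn_eField hn0
    (hn.of_le (le_self_add.trans le_self_add)) hm hr) i
  have hE (i : Fin 3) := contDiffOn_component (contDiffOn_elec hn0 hn hm hr) i
  have key (i j : Fin 3) := ((he i).mul (hE j)).sub ((he j).mul (hE i))
  refine contDiffOn_euclidean.2 fun i => ?_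
  fin_cases i
  · exact key 1 2
  · exact key 2 0
  · exact key 0 1

theorem dirDeriv_scalarPot (hm : 0 < m₀) (hr : IsAdmissible m₀ r₂) (hp : p ∈ offPath r₂)
    (w : Spacetime) : dirDeriv w (scalarPot r₂) p
      = uField r₂ p * dirDeriv w (zField r₂) p + dirDeriv w (uField r₂) p * zField r₂ p :=
  dirDeriv_mul (differentiableAt_uField hm hr hp) (differentiableAt_zField hm hr hp) w

theorem dirDeriv_vectorPot (hm : 0 < m₀) (hr : IsAdmissible m₀ r₂) (hp : p ∈ offPath r₂)
    (w : Spacetime) : dirDeriv w (vectorPot r₂) p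
      = scalarPot r₂ p • dirDeriv w (tau r₂) p • acc r₂ p
        + dirDeriv w (scalarPot r₂) p • vel r₂ p := by
  rw [← dirDeriv_vel hm hr hp]
  exact dirDeriv_smul (differentiableAt_scalarPot hm hr hp) (differentiableAt_vel hm hr hp) w

theorem dirDeriv_vectorPot_component (hm : 0 < m₀) (hr : IsAdmissible m₀ r₂)
    (hp : p ∈ offPath r₂) (w : Spacetime) (i : Fin 3) :
    dirDeriv w (fun q => vectorPot r₂ q i) p
      = scalarPot r₂ p * (dirDeriv w (tau r₂) p * acc r₂ p i)
        + dirDeriv w (scalarPot r₂) p * vel r₂ p i := by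
  have h : DifferentiableAt ℝ (vectorPot r₂) p :=
    (differentiableAt_scalarPot hm hr hp).smul (differentiableAt_vel hm hr hp)
  rw [dirDeriv_apply h, dirDeriv_vectorPot hm hr hp]
  rfl

theorem elec_eq_potentials (hm : 0 < m₀) (hr : IsAdmissible m₀ r₂) (hp : p ∈ offPath r₂) :
    elec r₂ p = -grad (scalarPot r₂) p - partialT (vectorPot r₂) p := by
  ext i
  have hg : grad (scalarPot r₂) p i = dirDeriv (basisX i) (scalarPot r₂) p := rfl
  rw [partialT_eq, PiLp.sub_apply, PiLp.neg_apply, hg, dirDeriv_vectorPot hm hr hp,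
    elec_eq hm hr hp]
  simp only [PiLp.add_apply, PiLp.sub_apply, PiLp.smul_apply, smul_eq_mul]
  rw [dirDeriv_scalarPot hm hr hp, dirDeriv_scalarPot hm hr hp, dirDeriv_basisT_uField hm hr hp,
    dirDeriv_basisX_uField hm hr hp, dirDeriv_basisT_zField hm hr hp,
    dirDeriv_basisX_zField hm hr hp, dirDeriv_basisT_tau hm hr hp, scalarPot]
  ring

/-- One has ∇ × A = ∇φ × v + φ ∇τ × a. Here ∇τ is parallel to e, and ∇φ is a combination of e and v
whose v part drops out, so the curl has the form e × (βv - uz²a). The vector in brackets is E up to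
a multiple of e. -/
theorem magn_eq_curl (hm : 0 < m₀) (hr : IsAdmissible m₀ r₂) (hp : p ∈ offPath r₂) :
    magn r₂ p = curl (vectorPot r₂) p := by
  have key (i j : Fin 3) : eField r₂ p i * elec r₂ p j - eField r₂ p j * elec r₂ p i
      = dirDeriv (basisX i) (fun q => vectorPot r₂ q j) p
        - dirDeriv (basisX j) (fun q => vectorPot r₂ q i) p := by
    rw [dirDeriv_vectorPot_component hm hr hp, dirDeriv_vectorPot_component hm hr hp,
      elec_eq hm hr hp]
    simp only [PiLp.add_apply, PiLp.sub_apply, PiLp.smul_apply, smul_eq_mul]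
    rw [dirDeriv_scalarPot hm hr hp, dirDeriv_scalarPot hm hr hp,
      dirDeriv_basisX_uField hm hr hp, dirDeriv_basisX_uField hm hr hp,
      dirDeriv_basisX_zField hm hr hp, dirDeriv_basisX_zField hm hr hp,
      dirDeriv_basisX_tau hm hr hp, dirDeriv_basisX_tau hm hr hp, scalarPot]
    ring
  ext i
  fin_cases i
  · exact key 1 2
  · exact key 2 0
  · exact key 0 1

theorem eField_sq_sum (hm : 0 < m₀) (hr : IsAdmissible m₀ r₂) (hp : p ∈ offPath r₂) :
    eField r₂ p 0 ^ 2 + eField r₂ p 1 ^ 2 + eField r₂ p 2 ^ 2 = 1 := by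
  have h := EuclideanSpace.norm_sq_eq (eField r₂ p)
  rw [norm_eField hm hr hp] at h
  simp only [Fin.sum_univ_three, Real.norm_eq_abs, sq_abs] at h
  linarith

theorem zField_mul_sum (hm : 0 < m₀) (hr : IsAdmissible m₀ r₂) (p : Spacetime) :
    zField r₂ p * (eField r₂ p 0 * vel r₂ p 0 + eField r₂ p 1 * vel r₂ p 1
      + eField r₂ p 2 * vel r₂ p 2) = zField r₂ p - 1 := by
  rw [← inner_eq_sum, zField_mul_inner hm hr]

/-- The sum is a polynomial that vanishes once ⟨v, v⟩ and ⟨e, a⟩ are expanded in coordinates and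
z⟨e, v⟩ = z - 1 is used. -/
theorem gauge_potentials (hm : 0 < m₀) (hr : IsAdmissible m₀ r₂) (hp : p ∈ offPath r₂) :
    div (vectorPot r₂) p + partialT (scalarPot r₂) p = 0 := by
  simp only [div, partialX_eq, partialT_eq, Fin.sum_univ_three,
    dirDeriv_vectorPot_component hm hr hp, dirDeriv_scalarPot hm hr hp,
    dirDeriv_basisT_uField hm hr hp, dirDeriv_basisX_uField hm hr hp,
    dirDeriv_basisT_zField hm hr hp, dirDeriv_basisX_zField hm hr hp,
    dirDeriv_basisX_tau hm hr hp, scalarPot]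
  have hv := inner_eq_sum (vel r₂ p) (vel r₂ p)
  have ha := inner_eq_sum (eField r₂ p) (acc r₂ p)
  have hq := zField_mul_sum hm hr p
  set u := uField r₂ p
  set z := zField r₂ p
  set N := inner ℝ (vel r₂ p) (vel r₂ p)
  set r := inner ℝ (eField r₂ p) (acc r₂ p)
  linear_combination (-(u ^ 2 * z ^ 2)) * hv + (u * z ^ 2) * ha
    + (-(u ^ 2 * z ^ 2) + u ^ 2 * z ^ 2 * N - u * z ^ 2 * r) * hq

/-- The field `z` is constant along the light rays emitted by the trajectory. -/
theorem sum_eField_mul_dirDeriv_zField (hm : 0 < m₀) (hr : IsAdmissible m₀ r₂)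
    (hp : p ∈ offPath r₂) :
    eField r₂ p 0 * dirDeriv (basisX 0) (zField r₂) p
      + eField r₂ p 1 * dirDeriv (basisX 1) (zField r₂) p
      + eField r₂ p 2 * dirDeriv (basisX 2) (zField r₂) p = -dirDeriv basisT (zField r₂) p := by
  rw [dirDeriv_basisX_zField hm hr hp, dirDeriv_basisX_zField hm hr hp,
    dirDeriv_basisX_zField hm hr hp, dirDeriv_basisT_zField hm hr hp]
  have hS := eField_sq_sum hm hr hp
  have hq := zField_mul_sum hm hr p
  set u := uField r₂ p
  set z := zField r₂ p
  set N := inner ℝ (vel r₂ p) (vel r₂ p)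
  set r := inner ℝ (eField r₂ p) (acc r₂ p)
  linear_combination (-(u * z ^ 2 * (z - 1)) + u * z ^ 3 * N - z ^ 3 * r) * hS + (u * z) * hq

/-! ### Wave equations for the potentials. -/

theorem dirDeriv_dirDeriv_tau_basisT (hm : 0 < m₀) (hr : IsAdmissible m₀ r₂)
    (hp : p ∈ offPath r₂) :
    dirDeriv basisT (dirDeriv basisT (tau r₂)) p = dirDeriv basisT (zField r₂) p :=
  dirDeriv_congr (isOpen_offPath hr) (fun _ hq => dirDeriv_basisT_tau hm hr hq) hp _

theorem dirDeriv_dirDeriv_tau_basisX (hm : 0 < m₀) (hr : IsAdmissible m₀ r₂)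
    (hp : p ∈ offPath r₂) (i : Fin 3) :
    dirDeriv (basisX i) (dirDeriv (basisX i) (tau r₂)) p =
      -(zField r₂ p * dirDeriv (basisX i) (eField r₂) p i
        + dirDeriv (basisX i) (zField r₂) p * eField r₂ p i) := by
  have hz := differentiableAt_zField hm hr hp
  have he := differentiableAt_eField hm hr hp
  have hei : DifferentiableAt ℝ (fun q => eField r₂ q i) p :=
    (EuclideanSpace.proj i : R3 →L[ℝ] ℝ).differentiableAt.comp p he
  rw [dirDeriv_congr (isOpen_offPath hr) (fun q hq => dirDeriv_basisX_tau hm hr hq i) hp,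
    dirDeriv_neg (hz.fun_mul hei), dirDeriv_mul hz hei, dirDeriv_apply he]

/-- From ∇τ = -ze and Dτ = z, □²τ = -z ∇ · e - (e · ∇z + Dz). The bracket vanishes because z is
constant along light rays, and ∇ · e = 2u. -/
theorem box_tau (hm : 0 < m₀) (hr : IsAdmissible m₀ r₂) (hp : p ∈ offPath r₂) :
    box (tau r₂) p = -2 * scalarPot r₂ p := by
  rw [box_eq, scalarPot]
  simp only [Fin.sum_univ_three, dirDeriv_dirDeriv_tau_basisX hm hr hp,
    dirDeriv_dirDeriv_tau_basisT hm hr hp, dirDeriv_basisX_eField hm hr hp]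
  linear_combination -sum_eField_mul_dirDeriv_zField hm hr hp
    + uField r₂ p * zField r₂ p ^ 2 * eField_sq_sum hm hr hp
    - uField r₂ p * zField r₂ p * zField_mul_sum hm hr p

theorem contDiffOn_dirDeriv_tau (hm : 0 < m₀) (hr : IsAdmissible m₀ r₂) (w : Spacetime) :
    ContDiffOn ℝ 2 (dirDeriv w (tau r₂)) (offPath r₂) :=
  ContDiffOn.dirDeriv (isOpen_offPath hr) (contDiffOn_tau (by simp) hr.contDiff hm hr)
    (by norm_num) w

theorem differentiableAt_dirDeriv_tau (hm : 0 < m₀) (hr : IsAdmissible m₀ r₂)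
    (hp : p ∈ offPath r₂) (w : Spacetime) : DifferentiableAt ℝ (dirDeriv w (tau r₂)) p :=
  differentiableAt_of_contDiffOn (isOpen_offPath hr) (contDiffOn_dirDeriv_tau hm hr w)
    (by simp) hp

theorem dirDeriv_dirDeriv_uField (hm : 0 < m₀) (hr : IsAdmissible m₀ r₂) (hp : p ∈ offPath r₂)
    (w : Spacetime) :
    dirDeriv w (dirDeriv w (uField r₂)) p =
      2 * uField r₂ p ^ 3 * (w.2 - dirDeriv w (tau r₂) p) ^ 2
        + uField r₂ p ^ 2 * dirDeriv w (dirDeriv w (tau r₂)) p := by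
  have hu := differentiableAt_uField hm hr hp
  have ht := differentiableAt_dirDeriv_tau hm hr hp w
  have h : Set.EqOn (dirDeriv w (uField r₂))
      (fun q => uField r₂ q * uField r₂ q * (dirDeriv w (tau r₂) q - w.2)) (offPath r₂) := by
    intro q hq
    dsimp only
    rw [dirDeriv_uField hm hr hq]
    ring
  rw [dirDeriv_congr (isOpen_offPath hr) h hp,
    dirDeriv_mul (hu.fun_mul hu) (ht.sub_const _), dirDeriv_mul hu hu,
    dirDeriv_sub ht (differentiableAt_const _), dirDeriv_uField hm hr hp,
    dirDeriv_of_hasFDerivAt (hasFDerivAt_const (w.2 : ℝ) p)]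
  simp only [zero_apply]
  ring

/-- With u = 1/T and T = t - τ, □²u = 2u³(|∇T|² - (DT)²) - u²□²T, where |∇T|² - (DT)² = z² - (1 -
z)² = 2z - 1 and □²T = 2uz. -/
theorem box_uField (hm : 0 < m₀) (hr : IsAdmissible m₀ r₂) (hp : p ∈ offPath r₂) :
    box (uField r₂) p = 2 * uField r₂ p ^ 3 * (zField r₂ p - 1) := by
  have hb := box_tau hm hr hp
  rw [box_eq] at hb ⊢
  simp only [Fin.sum_univ_three, dirDeriv_dirDeriv_uField hm hr hp, dirDeriv_basisT_tau hm hr hp,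
    dirDeriv_basisX_tau hm hr hp] at hb ⊢
  simp only [basisX, basisT, scalarPot] at hb ⊢
  linear_combination uField r₂ p ^ 2 * hb
    + 2 * uField r₂ p ^ 3 * zField r₂ p ^ 2 * eField_sq_sum hm hr hp

/-- Since z = Dτ and τ is C³, `box` passes through D and acts on τ. This avoids second derivatives
of z, which would bring in the third derivative of r₂. -/
theorem box_zField (hm : 0 < m₀) (hr : IsAdmissible m₀ r₂) (hp : p ∈ offPath r₂) :
    box (zField r₂) p = -2 * dirDeriv basisT (scalarPot r₂) p := by
  have hG := isOpen_offPath hr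
  rw [← box_congr hG (fun q hq => dirDeriv_basisT_tau hm hr hq) hp,
    box_dirDeriv hG (contDiffOn_tau (by simp) hr.contDiff hm hr) hp,
    dirDeriv_congr hG (fun q hq => box_tau hm hr hq) hp,
    dirDeriv_mul (differentiableAt_const _) (differentiableAt_scalarPot hm hr hp),
    dirDeriv_of_hasFDerivAt (hasFDerivAt_const (-2 : ℝ) p)]
  simp only [zero_apply, zero_mul, add_zero]

/-- In the product rule for uz, ∇u = -u²ze makes the mixed term a multiple of Dz, by constancy of z
along rays; it cancels against the contributions of □²z and □²u. -/
theorem box_scalarPot (hm : 0 < m₀) (hr : IsAdmissible m₀ r₂) (hp : p ∈ offPath r₂) :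
    box (scalarPot r₂) p = 0 := by
  have h := box_smul (isOpen_offPath hr)
    (contDiffOn_uField (n := 2) (by simp) (hr.contDiff.of_le (by norm_num)) hm hr)
    (contDiffOn_zField (n := 2) (by simp) hr.contDiff hm hr) hp
  refine Eq.trans (show box (scalarPot r₂) p = _ from h) ?_
  simp only [Fin.sum_univ_three, smul_eq_mul, box_zField hm hr hp, box_uField hm hr hp,
    dirDeriv_scalarPot hm hr hp, dirDeriv_basisT_uField hm hr hp, dirDeriv_basisX_uField hm hr hp]
  linear_combination -2 * uField r₂ p ^ 2 * zField r₂ p *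
    sum_eField_mul_dirDeriv_zField hm hr hp

/-- The eikonal equation, from ∇τ = -ze, Dτ = z and |e| = 1. -/
theorem sum_dirDeriv_tau_sq (hm : 0 < m₀) (hr : IsAdmissible m₀ r₂) (hp : p ∈ offPath r₂) :
    dirDeriv (basisX 0) (tau r₂) p ^ 2 + dirDeriv (basisX 1) (tau r₂) p ^ 2
      + dirDeriv (basisX 2) (tau r₂) p ^ 2 = dirDeriv basisT (tau r₂) p ^ 2 := by
  rw [dirDeriv_basisX_tau hm hr hp, dirDeriv_basisX_tau hm hr hp, dirDeriv_basisX_tau hm hr hp,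
    dirDeriv_basisT_tau hm hr hp]
  linear_combination zField r₂ p ^ 2 * eField_sq_sum hm hr hp

/-- By the chain rule the third derivative of r₂ enters with the factor |∇τ|² - (Dτ)², which is
zero. -/
theorem box_vel (hm : 0 < m₀) (hr : IsAdmissible m₀ r₂) (hp : p ∈ offPath r₂) :
    box (vel r₂) p = box (tau r₂) p • acc r₂ p := by
  have key (w : Spacetime) : dirDeriv w (dirDeriv w (vel r₂)) p
      = dirDeriv w (dirDeriv w (tau r₂)) p • acc r₂ p
        + dirDeriv w (tau r₂) p ^ 2 • deriv (deriv (deriv r₂)) (tau r₂ p) := by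
    have ha : dirDeriv w (acc r₂) p
        = dirDeriv w (tau r₂) p • deriv (deriv (deriv r₂)) (tau r₂ p) :=
      dirDeriv_comp_tau hm hr hp ((hr.contDiff.iterate_deriv' 1 2).differentiable (by simp) _) w
    rw [dirDeriv_congr (isOpen_offPath hr) (fun q hq => dirDeriv_vel hm hr hq w) hp,
      dirDeriv_smul (differentiableAt_dirDeriv_tau hm hr hp w) (differentiableAt_acc hm hr hp), ha]
    module
  simp only [box_eq, key, Fin.sum_univ_three, ← sum_dirDeriv_tau_sq hm hr hp]
  module

theorem box_vectorPot (hm : 0 < m₀) (hr : IsAdmissible m₀ r₂) (hp : p ∈ offPath r₂) :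
    box (vectorPot r₂) p = 0 := by
  have h := box_smul (isOpen_offPath hr) (contDiffOn_scalarPot (n := 2) (by simp) hr.contDiff hm hr)
    (contDiffOn_vel (n := 2) (by simp) hr.contDiff hm hr) hp
  refine Eq.trans (show box (vectorPot r₂) p = _ from h) ?_
  -- The coefficient of a in □²(φv). It vanishes by transport along the ray: z is constant and u has
  -- derivative -u² in the direction (e, 1), so the doubled bracket equals 2φ², while φ□²τ = -2φ².
  have hc : scalarPot r₂ p * box (tau r₂) p
      + 2 * (dirDeriv (basisX 0) (scalarPot r₂) p * dirDeriv (basisX 0) (tau r₂) p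
        + dirDeriv (basisX 1) (scalarPot r₂) p * dirDeriv (basisX 1) (tau r₂) p
        + dirDeriv (basisX 2) (scalarPot r₂) p * dirDeriv (basisX 2) (tau r₂) p
        - dirDeriv basisT (scalarPot r₂) p * dirDeriv basisT (tau r₂) p) = 0 := by
    simp only [box_tau hm hr hp, dirDeriv_scalarPot hm hr hp, dirDeriv_basisX_tau hm hr hp,
      dirDeriv_basisT_tau hm hr hp, dirDeriv_basisX_uField hm hr hp,
      dirDeriv_basisT_uField hm hr hp, scalarPot]
    linear_combination -2 * uField r₂ p * zField r₂ p * sum_eField_mul_dirDeriv_zField hm hr hp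
      + 2 * uField r₂ p ^ 2 * zField r₂ p ^ 3 * eField_sq_sum hm hr hp
  rw [box_scalarPot hm hr hp, box_vel hm hr hp]
  simp only [dirDeriv_vel hm hr hp, Fin.sum_univ_three]
  refine Eq.trans ?_ ((congrArg (· • acc r₂ p) hc).trans (zero_smul ℝ _))
  module

end Trajectory

end BogdanFeynman

end

/-! ### Assembly of the main theorem. -/

theorem mainTheorem1 (m₀ : ℝ) (hm : 0 < m₀) (r₂ : ℝ → R3) (hr : IsAdmissible m₀ r₂) :
    -- regularity of the fields on the open set of points off the path
    IsOpen (offPath r₂) ∧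
    ContDiffOn ℝ 3 (uField r₂) (offPath r₂) ∧ ContDiffOn ℝ 3 (eField r₂) (offPath r₂) ∧
    ContDiffOn ℝ 2 (scalarPot r₂) (offPath r₂) ∧ ContDiffOn ℝ 2 (vectorPot r₂) (offPath r₂) ∧
    ContDiffOn ℝ 1 (elec r₂) (offPath r₂) ∧ ContDiffOn ℝ 1 (magn r₂) (offPath r₂) ∧
    -- the homogeneous Maxwell equations
    (∀ p ∈ offPath r₂,
      curl (elec r₂) p = -partialT (magn r₂) p ∧ div (elec r₂) p = 0 ∧
      curl (magn r₂) p = partialT (elec r₂) p ∧ div (magn r₂) p = 0) ∧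
    -- the homogeneous wave equations, in the sense of distributions
    WeakWaveOn (offPath r₂) (elec r₂) ∧ WeakWaveOn (offPath r₂) (magn r₂) ∧
    -- and pointwise wherever the fields are of class C²
    (∀ U : Set Spacetime, IsOpen U → U ⊆ offPath r₂ →
      ContDiffOn ℝ 2 (elec r₂) U → ContDiffOn ℝ 2 (magn r₂) U →
      ∀ p ∈ U, box (elec r₂) p = 0 ∧ box (magn r₂) p = 0) ∧
    -- in particular everywhere off the path, if the trajectory is of class C⁴
    (ContDiff ℝ 4 r₂ →
      ContDiffOn ℝ 2 (elec r₂) (offPath r₂) ∧ ContDiffOn ℝ 2 (magn r₂) (offPath r₂) ∧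
      ∀ p ∈ offPath r₂, box (elec r₂) p = 0 ∧ box (magn r₂) p = 0) ∧
    -- the potentials: wave equations, Lorentz gauge, and the fields they generate
    (∀ p ∈ offPath r₂,
      box (vectorPot r₂) p = 0 ∧ box (scalarPot r₂) p = 0 ∧
      div (vectorPot r₂) p + partialT (scalarPot r₂) p = 0 ∧
      elec r₂ p = -grad (scalarPot r₂) p - partialT (vectorPot r₂) p ∧
      magn r₂ p = curl (vectorPot r₂) p) ∧
    -- the explicit formula for the field E
    (∀ p ∈ offPath r₂, ∀ (u z : ℝ) (e v a : R3),
      u = uField r₂ p → z = zField r₂ p → e = eField r₂ p → v = vel r₂ p → a = acc r₂ p →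
      elec r₂ p =
        -(u * z ^ 2) • a + (u * z ^ 3 * inner ℝ e a) • e - (u * z ^ 3 * inner ℝ e a) • v
          + (u ^ 2 * z ^ 3) • e - (u ^ 2 * z ^ 3 * inner ℝ v v) • e
          - (u ^ 2 * z ^ 3) • v + (u ^ 2 * z ^ 3 * inner ℝ v v) • v) := by
  have hG := isOpen_offPath hr
  have hφ : ContDiffOn ℝ 2 (scalarPot r₂) (offPath r₂) :=
    contDiffOn_scalarPot (by simp) hr.contDiff hm hr
  have hA : ContDiffOn ℝ 2 (vectorPot r₂) (offPath r₂) :=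
    contDiffOn_vectorPot (by simp) hr.contDiff hm hr
  have h3 : ContDiff ℝ (1 + 1 + 1) r₂ := hr.contDiff.of_le (by norm_num)
  have hE1 : ContDiffOn ℝ 1 (elec r₂) (offPath r₂) := contDiffOn_elec (by simp) h3 hm hr
  have hB1 : ContDiffOn ℝ 1 (magn r₂) (offPath r₂) := contDiffOn_magn (by simp) h3 hm hr
  have hE := fun p (hp : p ∈ offPath r₂) => elec_eq_potentials hm hr hp
  have hB := fun p (hp : p ∈ offPath r₂) => magn_eq_curl hm hr hp
  have hboxφ := fun p (hp : p ∈ offPath r₂) => box_scalarPot hm hr hp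
  have hboxA := fun p (hp : p ∈ offPath r₂) => box_vectorPot hm hr hp
  have hgauge := fun p (hp : p ∈ offPath r₂) => gauge_potentials hm hr hp
  have hwE := weakWaveOn_electric hG hφ hA hE1 hE hboxφ hboxA
  have hwB := weakWaveOn_magnetic hG hA hB1 hB hboxA
  have hpt : ∀ U : Set Spacetime, IsOpen U → U ⊆ offPath r₂ →
      ContDiffOn ℝ 2 (elec r₂) U → ContDiffOn ℝ 2 (magn r₂) U →
      ∀ p ∈ U, box (elec r₂) p = 0 ∧ box (magn r₂) p = 0 := fun U hU hUG h2E h2B p hp =>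
    ⟨hwE.box_eq_zero hU hUG h2E hp, hwB.box_eq_zero hU hUG h2B hp⟩
  refine ⟨hG, contDiffOn_uField (by simp) hr.contDiff hm hr,
    contDiffOn_eField (by simp) hr.contDiff hm hr, hφ, hA, hE1, hB1,
    fun p hp => maxwell_of_potentials hG hφ hA hE1 hB1 hE hB hboxφ hboxA hgauge hp,
    hwE, hwB, hpt, fun h4 => ?_,
    fun p hp => ⟨hboxA p hp, hboxφ p hp, hgauge p hp, hE p hp, hB p hp⟩, ?_⟩
  · have h4' : ContDiff ℝ (2 + 1 + 1) r₂ := h4.of_le (by norm_num)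
    have h2E : ContDiffOn ℝ 2 (elec r₂) (offPath r₂) := contDiffOn_elec (by simp) h4' hm hr
    have h2B : ContDiffOn ℝ 2 (magn r₂) (offPath r₂) := contDiffOn_magn (by simp) h4' hm hr
    exact ⟨h2E, h2B, hpt _ hG subset_rfl h2E h2B⟩
  · rintro p hp _ _ _ _ _ rfl rfl rfl rfl rfl
    exact elec_eq hm hr hp
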